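/- Let $\mathcal O$ be a Dedekind domain of characteristic zero with fraction field $K$, let $\mathfrak p$ be a maximal ideal of $\mathcal O$ with localization $\mathcal O_{\mathfrak p}$, and let $k=\mathcal O/\mathfrak p=\mathcal O_{\mathfrak p}/\mathfrak p\mathcal O_{\mathfrak p}$ have characteristic $p>0$. Let $G$ be a finite group, and assume that $K$ and $k$ are splitting fields for all subgroups of $G$. Let $\mathcal R(G)$ be the Grothendieck ring of the category of finite-dimensional $KG$-modules, identified with the ring of virtual characters, a subring of the ring of functions $G\to K$. For a commutative ring $R$ put $R\mathcal R(G)=R\otimes_{\mathbb Z}\mathcal R(G)$. Virtual characters take values in $\mathcal O$. For a conjugacy class $C$ of $G$, let $\overline{\mathrm{ev}}_C:k\mathcal R(G)\to k$ be the $k$-algebra morphism with $\overline{\mathrm{ev}}_C(a\otimes\chi)=a\cdot(\chi(C)\bmod\mathfrak p)$, and let $\bar{\mathcal D}_C$ be the simple $k\mathcal R(G)$-module equal to $k$ as a vector space, on which $k\mathcal R(G)$ acts through $\overline{\mathrm{ev}}_C$. For a class $C$ of $p$-regular elements let $\mathcal S_{p'}(C)=\{g\in G : g_{p'}\in C\}$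 be its $p'$-section, where $g_{p'}$ is the $p'$-part of $g$; it is a union of conjugacy classes of $G$. Let $C$ be a conjugacy class of $p$-regular elements of $G$. Then the characteristic function of $\mathcal S_{p'}(C)$ is the image of a unique element $e_C$ of $\mathcal O_{\mathfrak p}\mathcal R(G)$ under the canonical map from $\mathcal O_{\mathfrak p}\mathcal R(G)$ to the functions $G\to K$. Let $\bar e_C\in k\mathcal R(G)$ be the reduction of $e_C$ modulo $\mathfrak p$, and let $\bar{\mathcal P}_C=k\mathcal R(G)\bar e_C$. Then $\bar{\mathcal P}_C$ is an indecomposable projective $k\mathcal R(G)$-module with a Jordan–Hölder series, and: (a) For every conjugacy class $C'$ of $p$-regular elements of $G$, the multiplicity $[\bar{\mathcal P}_C:\bar{\mathcal D}_{C'}]$ of $\bar{\mathcal D}_{C'}$ as a Jordan–Hölder factor of $\bar{\mathcal P}_C$ is the number of conjugacy classes of $G$ contained in $\mathcal S_{p'}(C)$ if $C'=C$, and is $0$ if $C'\neq C$. (b) $\bar{\mathcal P}_C/\mathrm{Rad}\,\bar{\mathcal P}_C\simeq\bar{\mathcal D}_C$, where $\mathrm{Rad}$ denotes the radical of a module. (c)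 $\dim_k\bar{\mathcal P}_C$ is the number of conjugacy classes of $G$ contained in $\mathcal S_{p'}(C)$, and for every $g\in C$ it is also the number of $C_G(g)$-conjugacy classes of $p$-elements of the centralizer $C_G(g)$. -/

import Mathlib

open scoped TensorProduct

namespace CharacterRing

/-! ### Splitting fields -/

/-- `F` is a splitting field for the group `H`: every simple `F[H]`-module has only the scalars as
endomorphisms. (Every simple module over the group algebra of a finite group is
finite-dimensional, so up to isomorphism it is a matrix representation on some `Fⁿ`.) -/
def IsSplittingField (F : Type*) [Field F] (H : Type*) [Group H] : Prop :=
  ∀ (n : ℕ) (ρ : Representation F H (Fin n → F)), ρ.IsIrreducible →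
    ∀ f : Module.End F (Fin n → F), (∀ h, f ∘ₗ ρ h = ρ h ∘ₗ f) →
      ∃ c : F, f = c • LinearMap.id

/-! ### The character ring -/

/-- The set of characters of the finite-dimensional representations of `G` over `K`. -/
def characters (K : Type*) [Field K] (G : Type*) [Group G] : Set (G → K) :=
  {χ | ∃ (n : ℕ) (ρ : Representation K G (Fin n → K)), χ = ρ.character}

theorem character_mem {K : Type*} [Field K] {G : Type*} [Group G] {V : Type*} [AddCommGroup V]
    [Module K V] [FiniteDimensional K V] (ρ : Representation K G V) :
    ρ.character ∈ characters K G := by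
  let e : V ≃ₗ[K] (Fin (Module.finrank K V) → K) := (Module.finBasis K V).equivFun
  refine ⟨Module.finrank K V,
    { toFun := fun g => e.conj (ρ g)
      map_one' := by ext; simp [LinearEquiv.conj_apply]
      map_mul' := fun g h => by
        rw [map_mul]
        exact e.conj_comp _ _ }, ?_⟩
  funext g
  exact (LinearMap.trace_conj' (ρ g) e).symm

/-- The character ring of `G` over `K`: the ring of virtual characters, that is the additive
group of class functions generated by the characters of the finite-dimensional representations,
with pointwise multiplication. For `K` of characteristic zero this is the Grothendieck ring of the
category of finite-dimensional `KG`-modules. -/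
def charRing (K : Type*) [Field K] (G : Type*) [Group G] : Subring (G → K) where
  carrier := AddSubgroup.closure (characters K G)
  zero_mem' := zero_mem _
  add_mem' := add_mem
  neg_mem' := neg_mem
  one_mem' := by
    refine AddSubgroup.subset_closure ?_
    have h := character_mem (Representation.trivial K G K)
    convert h using 1
    funext g
    simp [Representation.character]
  mul_mem' := by
    intro a b ha hb
    refine AddSubgroup.closure_induction₂
      (p := fun x y _ _ => x * y ∈ AddSubgroup.closure (characters K G))
      ?_ ?_ ?_ ?_ ?_ ?_ ?_ ha hb
    · rintro _ _ ⟨n, ρ, rfl⟩ ⟨m, σ, rfl⟩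
      rw [← Representation.char_tensor]
      exact AddSubgroup.subset_closure (character_mem _)
    · intro x _; simp [zero_mem]
    · intro x _; simp [zero_mem]
    · intro x y z _ _ _ h1 h2; rw [add_mul]; exact add_mem h1 h2
    · intro x y z _ _ _ h1 h2; rw [mul_add]; exact add_mem h1 h2
    · intro x y _ _ h; rw [neg_mul]; exact neg_mem h
    · intro x y _ _ h; rw [mul_neg]; exact neg_mem h

/-- Virtual characters are class functions. -/
theorem charRing_conj {K : Type*} [Field K] {G : Type*} [Group G] (f : charRing K G) {g h : G}
    (hgh : IsConj g h) : f.1 g = f.1 h := by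
  obtain ⟨c, rfl⟩ := isConj_iff.1 hgh
  refine AddSubgroup.closure_induction (p := fun x _ => x g = x (c * g * c⁻¹))
    ?_ ?_ ?_ ?_ f.2
  · rintro _ ⟨n, ρ, rfl⟩
    rw [Representation.char_conj]
  · rfl
  · intro x y _ _ h1 h2; simp only [Pi.add_apply, h1, h2]
  · intro x _ h1; simp only [Pi.neg_apply, h1]

/-- Values of virtual characters of a finite group are algebraic integers. -/
theorem charRing_isIntegral {K : Type*} [Field K] {G : Type*} [Group G] [Finite G]
    (f : charRing K G) (g : G) : IsIntegral ℤ (f.1 g) := by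
  refine AddSubgroup.closure_induction (p := fun x _ => IsIntegral ℤ (x g))
    ?_ ?_ ?_ ?_ f.2
  · rintro _ ⟨n, ρ, rfl⟩
    let L := AlgebraicClosure K
    have hinj : Function.Injective (algebraMap K L) := (algebraMap K L).injective
    let M : Matrix (Fin n) (Fin n) K := LinearMap.toMatrix' (ρ g)
    have htr : ρ.character g = M.trace := by
      rw [Representation.character, LinearMap.trace_eq_matrix_trace K (Pi.basisFun K (Fin n))]
      rfl
    have hpow : M ^ (Nat.card G) = 1 := by
      have h1 : (ρ g) ^ (Nat.card G) = 1 := by rw [← map_pow, pow_card_eq_one', map_one]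
      have h2 := congrArg LinearMap.toMatrixAlgEquiv' h1
      rw [map_pow, map_one] at h2
      exact h2
    let N : Matrix (Fin n) (Fin n) L := (algebraMap K L).mapMatrix M
    have hN : N ^ (Nat.card G) = 1 := by
      rw [← map_pow, hpow, map_one]
    have hNt : algebraMap K L M.trace = N.trace := by
      simp [N, Matrix.trace, map_sum]
    rw [htr, ← isIntegral_algHom_iff ((algebraMap K L).toIntAlgHom) hinj]
    change IsIntegral ℤ (algebraMap K L M.trace)
    rw [hNt, Matrix.trace_eq_sum_roots_charpoly N]
    refine IsIntegral.multiset_sum ?_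
    intro x hx
    have hx' : x ∈ spectrum L N := by
      rw [Matrix.mem_spectrum_iff_isRoot_charpoly]
      exact (Polynomial.mem_roots'.1 hx).2
    have hx2 : x ^ (Nat.card G) ∈ spectrum L (N ^ (Nat.card G)) := spectrum.pow_mem_pow N _ hx'
    have hx3 : x ^ (Nat.card G) = 1 := by
      rw [hN] at hx2
      have : Nontrivial (Matrix (Fin n) (Fin n) L) := by
        by_contra hnt
        rw [not_nontrivial_iff_subsingleton] at hnt
        exact hx2 (isUnit_of_subsingleton _)
      rw [spectrum.one_eq] at hx2
      exact hx2
    exact IsIntegral.of_pow Nat.card_pos (by rw [hx3]; exact isIntegral_one)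
  · exact isIntegral_zero
  · intro x y _ _ h1 h2; exact h1.add h2
  · intro x _ h1; exact h1.neg

/-! ### Conjugacy classes, `p`-parts and `p'`-parts -/

/-- `g` is a `p`-element: its order is a power of `p`. -/
def IsPElement (p : ℕ) {G : Type*} [Group G] (g : G) : Prop := ∃ a : ℕ, orderOf g = p ^ a

/-- `C` is a class of `p`-regular elements: their order is prime to `p`. -/
def IsPRegularClass (p : ℕ) {G : Type*} [Group G] (C : ConjClasses G) : Prop :=
  ∀ g ∈ C.carrier, (orderOf g).Coprime p

/-- The `p'`-part `g_{p'}` of an element `g` of finite order: the power `g ^ m`, where `m` is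
divisible by the `p`-part of the order of `g` and is congruent to `1` modulo its `p'`-part. -/
noncomputable def pPrimePart (p : ℕ) [Fact p.Prime] {G : Type*} [Group G] [Finite G] (g : G) : G :=
  g ^ (Nat.chineseRemainder (n := ordCompl[p] (orderOf g)) (m := ordProj[p] (orderOf g))
    ((Nat.coprime_ordCompl (Fact.out : p.Prime) (orderOf_pos g).ne').pow_left _).symm 1 0 : ℕ)

/-- The `p'`-section of the class `C`: the elements whose `p'`-part lies in `C`. -/
def pPrimeSection (p : ℕ) [Fact p.Prime] {G : Type*} [Group G] [Finite G] (C : ConjClasses G) :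
    Set G :=
  {g | pPrimePart p g ∈ C.carrier}

/-- The number of conjugacy classes of `G` contained in the subset `X`. -/
noncomputable def numClasses {G : Type*} [Group G] (X : Set G) : ℕ :=
  Nat.card {D : ConjClasses G // D.carrier ⊆ X}

/-! ### Multiplicities in Jordan–Hölder series -/

/-- The `i`-th factor of a composition series of submodules. -/
abbrev factor {A M : Type*} [Ring A] [AddCommGroup M] [Module A M]
    (s : CompositionSeries (Submodule A M)) (i : Fin s.length) : Type _ :=
  ↥(s i.succ) ⧸ (s i.castSucc).submoduleOf (s i.succ)

/-- `[M : S] = n`: the module `M` has a Jordan–Hölder series, and in each of them exactly `n`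
factors are isomorphic to `S`. -/
def HasMultiplicity (A M S : Type*) [Ring A] [AddCommGroup M] [Module A M]
    [AddCommGroup S] [Module A S] (n : ℕ) : Prop :=
  (∃ s : CompositionSeries (Submodule A M), s.head = ⊥ ∧ s.last = ⊤) ∧
  ∀ s : CompositionSeries (Submodule A M), s.head = ⊥ → s.last = ⊤ →
    Nat.card {i : Fin s.length // Nonempty (factor s i ≃ₗ[A] S)} = n

/-- `M` is an indecomposable module. -/
def IsIndecomposable (A M : Type*) [Ring A] [AddCommGroup M] [Module A M] : Prop :=
  Nontrivial M ∧ ∀ N N' : Submodule A M, IsCompl N N' → N = ⊥ ∨ N' = ⊥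

/-- The one-dimensional module `k` over `A` on which `A` acts through the character `f : A → k`. -/
def CharModule {A k : Type*} [CommRing A] [Field k] (_f : A →+* k) : Type _ := k

instance {A k : Type*} [CommRing A] [Field k] (f : A →+* k) : AddCommGroup (CharModule f) :=
  inferInstanceAs (AddCommGroup k)

instance {A k : Type*} [CommRing A] [Field k] (f : A →+* k) : Module A (CharModule f) :=
  Module.compHom k f

/-! ### Extension of scalars of the character ring -/

section Scalars

variable (R S K G : Type*) [CommRing R] [CommRing S] [Field K] [Group G]

/-- The `R`-algebra `R R(G) = R ⊗ R(G)`. -/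
def ScalarCharRing : Type _ := R ⊗[ℤ] charRing K G

noncomputable instance : CommRing (ScalarCharRing R K G) :=
  inferInstanceAs (CommRing (R ⊗[ℤ] charRing K G))

noncomputable instance : Algebra R (ScalarCharRing R K G) :=
  inferInstanceAs (Algebra R (R ⊗[ℤ] charRing K G))

variable {R K G} in
/-- The pure tensor `a ⊗ χ`. -/
def tensor (a : R) (χ : charRing K G) : ScalarCharRing R K G := a ⊗ₜ[ℤ] χ

variable {R S} in
/-- The map `R R(G) → S R(G)`, `a ⊗ χ ↦ φ a ⊗ χ`, induced by a ring homomorphism `φ : R → S`. -/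
noncomputable def mapScalars (φ : R →+* S) : ScalarCharRing R K G →+* ScalarCharRing S K G :=
  (Algebra.TensorProduct.map φ.toIntAlgHom (AlgHom.id ℤ (charRing K G))).toRingHom

variable {R K G} in
/-- The map `R R(G) → S`, `a ⊗ χ ↦ φ a * ψ χ`. -/
noncomputable def liftScalars (φ : R →+* S) (ψ : charRing K G →+* S) :
    ScalarCharRing R K G →+* S :=
  (Algebra.TensorProduct.productMap φ.toIntAlgHom ψ.toIntAlgHom).toRingHom

variable {R S K G} in
theorem mapScalars_tensor (φ : R →+* S) (a : R) (χ : charRing K G) :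
    mapScalars K G φ (tensor a χ) = tensor (φ a) χ := rfl

variable {R S K G} in
theorem liftScalars_tensor (φ : R →+* S) (ψ : charRing K G →+* S) (a : R) (χ : charRing K G) :
    liftScalars S φ ψ (tensor a χ) = φ a * ψ χ :=
  Algebra.TensorProduct.productMap_apply_tmul _ _ _ _

end Scalars

/-! ### Reduction modulo a maximal ideal -/

section Reduction

variable {O : Type*} [CommRing O] [IsDomain O] (P : Ideal O) [P.IsMaximal]
  (K : Type*) [Field K] [Algebra O K] [IsFractionRing O K] (G : Type*) [Group G]

/-- The embedding of the localization `O_𝔭` into the fraction field `K` of `O`. -/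
noncomputable def localizationToFraction : Localization.AtPrime P →+* K :=
  IsLocalization.lift (M := P.primeCompl) (g := algebraMap O K) fun y =>
    IsUnit.mk0 _ ((map_ne_zero_iff _ (IsFractionRing.injective O K)).2
      fun h => y.2 (h ▸ P.zero_mem))

/-- The canonical map of `O_𝔭 R(G)` to the ring of `K`-valued functions on `G`, sending `a ⊗ χ` to
`a χ`. -/
noncomputable def toFunctions : ScalarCharRing (Localization.AtPrime P) K G →+* (G → K) :=
  liftScalars (G → K) ((Pi.constRingHom G K).comp (localizationToFraction P K))
    (charRing K G).subtype

/-- Reduction `O_𝔭 R(G) → k R(G)` modulo `𝔭 O_𝔭`, where `k = O_𝔭 / 𝔭 O_𝔭 = O / 𝔭`. -/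
noncomputable def reduction :
    ScalarCharRing (Localization.AtPrime P) K G →+* ScalarCharRing P.ResidueField K G :=
  mapScalars K G (IsLocalRing.residue (Localization.AtPrime P))

section Eval

variable [IsIntegrallyClosed O] [Finite G]

variable {K G} in
set_option linter.unusedSectionVars false in
theorem exists_integral_value (f : charRing K G) (g : G) : ∃ x : O, algebraMap O K x = f.1 g :=
  IsIntegrallyClosed.isIntegral_iff.1 ((charRing_isIntegral f g).tower_top)

variable (O) {G} in
/-- Evaluation at `g` of virtual characters, with values in `O`. -/
noncomputable def evalAt (g : G) : charRing K G →+* O where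
  toFun f := (exists_integral_value f g).choose
  map_one' := IsFractionRing.injective O K (by
    rw [(exists_integral_value _ _).choose_spec, map_one]; rfl)
  map_zero' := IsFractionRing.injective O K (by
    rw [(exists_integral_value _ _).choose_spec, map_zero]; rfl)
  map_mul' a b := IsFractionRing.injective O K (by
    rw [map_mul]; simp only [(exists_integral_value _ _).choose_spec]; rfl)
  map_add' a b := IsFractionRing.injective O K (by
    rw [map_add]; simp only [(exists_integral_value _ _).choose_spec]; rfl)

variable {K G} in
theorem algebraMap_evalAt (g : G) (f : charRing K G) :
    algebraMap O K (evalAt O K g f) = f.1 g :=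
  (exists_integral_value f g).choose_spec

variable (O) {G} in
/-- The evaluation `ev_C : R(G) → O` at a conjugacy class `C`. -/
noncomputable def evalClass (C : ConjClasses G) : charRing K G →+* O :=
  Quotient.liftOn C (fun g => evalAt O K g) fun g h hgh => by
    ext f
    apply IsFractionRing.injective O K
    rw [algebraMap_evalAt, algebraMap_evalAt]
    exact charRing_conj f hgh

variable {G} in
/-- The reduction `k R(G) → k` of `ev_C` modulo `𝔭`, sending `a ⊗ χ` to `a` times the residue
class of `χ(C)`. -/
noncomputable def redEval (C : ConjClasses G) :
    ScalarCharRing P.ResidueField K G →+* P.ResidueField :=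
  liftScalars P.ResidueField (RingHom.id P.ResidueField)
    ((algebraMap O P.ResidueField).comp (evalClass O K C))

variable {G} in
/-- The simple `k R(G)`-module attached to the class `C`: the one-dimensional space `k`, on which
`k R(G)` acts through the reduction of `ev_C`. -/
abbrev simpleMod (C : ConjClasses G) : Type _ := CharModule (redEval P K C)

end Eval

end Reduction

end CharacterRing

open CharacterRing

/-!
The characteristic function `e` of the `p'`-section of `C` is an idempotent function, and elements
of `O_𝔭 R(G)` are determined by the functions that they define (`scalarFunctions_injective`): the
scalar products with suitable characters embed `R(G)` into some `ℤⁿ`, and `O_𝔭` is flat over `ℤ`.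

*Existence of `e`.* Let `x ∈ C` and let `Q` be a Sylow `p`-subgroup of the centralizer of `x`. The
function `b(g) = |Q|⁻¹ #{t | t⁻¹ g t ∈ x Q}` is a multiple of the one induced from the
characteristic function of `x Q` on `⟨x⟩ Q`. It is a combination of characters of `G`
with roots of unity as coefficients: on the space of functions on `G` it is the trace of `g`
followed by an operator `T` commuting with left translations, with `T ^ (m + 1) = T` for `m`
the order of `x`, and `T` is a combination of idempotents over the field `K`, which contains the `m`-th roots of unity (`exists_primitiveRoot`, `exists_charRing_eq_card`). The
function `b` is supported on the section and `b(x) = (C_G(x) : Q)` is prime to `p`. Virtual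
characters take congruent values at `g` and at its `p'`-part (`redEval_pPrimePart`), so the values
of `b` on the section are units of `O_𝔭`, and `e = 1 - ∏ (1 - b / b(h))`, the product being over
the section (`exists_toFunctions_eq_indicator`).

*Structure of the block.* If all the values of `b ∈ O_𝔭 R(G)` are in `𝔭 O_𝔭` then the identity
`∏ (b - b(g)) = 0` reduces to `b̄ ^ |G| = 0` (`isNilpotent_reduction`). Applied to the elements
`b e`, this shows that the kernel of the evaluation at `C` acts on the block `k R(G) ē` by nilpotent
elements. So the block is local, and all its simple subquotients are the one-dimensional module
of `C`; the composition length is then the dimension.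

*Dimension.* As `e` is idempotent, `O_𝔭 R(G) e` is free over the local ring `O_𝔭`, and its rank can
be computed over `k` as well as over `K` (`finrank_span_map_idempotent`,
`finrank_span_indicator`). Over `K` one gets the class functions supported on the section, because
class functions are combinations of characters (`mem_span_charRing`). The bijection
`u ↦ g u` gives the count by `p`-elements of the centralizer of `g` (`numClasses_pPrimeSection`).
-/

namespace CharacterRing

/-! ### The block of a commutative algebra cut out by an idempotent -/

section LocalBlock

variable {A k : Type*} [CommRing A] [Field k]

/-- The tautological `A`-linear map `A → CharModule f`. -/
def CharModule.mk (f : A →+* k) : A →ₗ[A] CharModule f where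
  toFun a := f a
  map_add' := map_add f
  map_smul' a b := map_mul f a b

theorem CharModule.mk_apply (f : A →+* k) (a : A) : CharModule.mk f a = f a := rfl

theorem CharModule.ker_mk (f : A →+* k) : LinearMap.ker (CharModule.mk f) = RingHom.ker f := by
  ext a; rfl

/-- A simple module annihilated by the kernel of a surjective character `f` is the
one-dimensional module attached to `f`. -/
theorem CharModule.nonempty_equiv_of_isSimpleModule (f : A →+* k) (hf : Function.Surjective f)
    (S : Type*) [AddCommGroup S] [Module A S] [IsSimpleModule A S]
    (h : ∀ a, f a = 0 → ∀ s : S, a • s = 0) : Nonempty (S ≃ₗ[A] CharModule f) := by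
  have := IsSimpleModule.nontrivial A S
  obtain ⟨s, hs⟩ := exists_ne (0 : S)
  have hsurj := IsSimpleModule.toSpanSingleton_surjective A hs
  have hmax : (RingHom.ker f).IsMaximal := RingHom.ker_isMaximal_of_surjective f hf
  have hle : RingHom.ker f ≤ LinearMap.ker (LinearMap.toSpanSingleton A S s) := by
    intro a ha
    exact h a ha s
  have hker : RingHom.ker f = LinearMap.ker (LinearMap.toSpanSingleton A S s) := by
    refine hmax.eq_of_le ?_ hle
    intro htop
    have h1 : (1 : A) ∈ LinearMap.ker (LinearMap.toSpanSingleton A S s) := by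
      rw [htop]; trivial
    simp at h1
    exact hs h1
  exact ⟨(LinearMap.quotKerEquivOfSurjective _ hsurj).symm ≪≫ₗ
    Submodule.quotEquivOfEq _ _ (hker.symm.trans (CharModule.ker_mk f).symm) ≪≫ₗ
    LinearMap.quotKerEquivOfSurjective (CharModule.mk f) hf⟩

/-- A locally nilpotent scalar acts as zero on a simple module. -/
theorem smul_eq_zero_of_isSimpleModule (S : Type*) [AddCommGroup S] [Module A S]
    [IsSimpleModule A S] (a : A) (n : ℕ) (h : ∀ s : S, a ^ n • s = 0) (s : S) : a • s = 0 := by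
  rcases LinearMap.bijective_or_eq_zero (LinearMap.lsmul A S a) with hb | h0
  · exfalso
    have := IsSimpleModule.nontrivial A S
    obtain ⟨t, ht⟩ := exists_ne (0 : S)
    have hinj : ∀ m : ℕ, a ^ m • t ≠ 0 := by
      intro m
      induction m with
      | zero => simpa using ht
      | succ m ih =>
        intro h0
        rw [pow_succ', mul_smul] at h0
        exact ih (hb.1 (h0.trans (smul_zero a).symm))
    exact hinj n (h t)
  · exact LinearMap.congr_fun h0 s

variable (f : A →+* k) (e : A) (he : e * e = e) (hfe : f e = 1)
  (hnil : ∀ a, f a = 0 → IsNilpotent (a * e))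

include he in
theorem mul_eq_of_mem_span {q : A} (hq : q ∈ Ideal.span {e}) : e * q = q := by
  obtain ⟨a, rfl⟩ := Ideal.mem_span_singleton'.1 hq
  linear_combination a * he

include he in
/-- The ideal generated by an idempotent is a direct summand, hence projective. -/
theorem projective_span_idempotent : Module.Projective A (Ideal.span {e}) := by
  refine Module.Projective.of_split (Submodule.subtype _)
    (LinearMap.toSpanSingleton A _ ⟨e, Ideal.mem_span_singleton_self e⟩) ?_
  ext q
  simp only [LinearMap.comp_apply, Submodule.subtype_apply, LinearMap.toSpanSingleton_apply,
    LinearMap.id_apply, SetLike.val_smul, smul_eq_mul]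
  rw [mul_comm, mul_eq_of_mem_span e he q.2]

include he hnil in
/-- The kernel of `f` annihilates the simple subquotients of `A e`: it acts on `A e` by
nilpotent elements. A subquotient is given by an injection `i` and a surjection `π`. -/
theorem smul_factor_eq_zero {S M : Type*} [AddCommGroup S] [Module A S] [IsSimpleModule A S]
    [AddCommGroup M] [Module A M] (i : M →ₗ[A] Ideal.span {e}) (hi : Function.Injective i)
    (π : M →ₗ[A] S) (hπ : Function.Surjective π) (a : A) (ha : f a = 0) (s : S) :
    a • s = 0 := by
  obtain ⟨n, hn⟩ := hnil a ha
  refine smul_eq_zero_of_isSimpleModule S a n ?_ s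
  intro s
  obtain ⟨m, rfl⟩ := hπ s
  rw [← map_smul]
  have : a ^ n • m = 0 := by
    apply hi
    rw [map_smul, map_zero]
    ext
    -- For `n = 0` the ring is trivial; otherwise `aⁿ e = (a e)ⁿ = 0`.
    rcases Nat.eq_zero_or_pos n with rfl | hpos
    · have h1 : (1 : A) = 0 := by simpa using hn
      simp only [SetLike.val_smul, smul_eq_mul, ZeroMemClass.coe_zero]
      rw [← mul_one (_ * _), h1, mul_zero]
    · simp only [SetLike.val_smul, smul_eq_mul, ZeroMemClass.coe_zero]
      rw [← mul_eq_of_mem_span e he (i m).2, ← mul_assoc]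
      have : a ^ n * e = 0 := by
        rw [mul_pow, (show IsIdempotentElem e from he).pow_eq hpos.ne'] at hn
        exact hn
      rw [this, zero_mul]
  rw [this, map_zero]

/-- The restriction of `f` to the block `A e`. -/
def blockHead : Ideal.span {e} →ₗ[A] CharModule f :=
  CharModule.mk f ∘ₗ Submodule.subtype _

variable [Algebra k A] (hf : ∀ c : k, f (algebraMap k A c) = c)

include hf he hnil in
/-- All the simple subquotients of the block `A e` are isomorphic to the module attached to `f`. -/
theorem nonempty_equiv_charModule_of_subquotient {S M : Type*} [AddCommGroup S] [Module A S]
    [IsSimpleModule A S] [AddCommGroup M] [Module A M] (i : M →ₗ[A] Ideal.span {e})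
    (hi : Function.Injective i) (π : M →ₗ[A] S) (hπ : Function.Surjective π) :
    Nonempty (S ≃ₗ[A] CharModule f) :=
  CharModule.nonempty_equiv_of_isSimpleModule f (fun c => ⟨_, hf c⟩) S
    fun a ha s => smul_factor_eq_zero f e he hnil i hi π hπ a ha s

include hfe hf in
theorem blockHead_surjective : Function.Surjective (blockHead f e) := by
  intro (c : k)
  refine ⟨(algebraMap k A c) • ⟨e, Ideal.mem_span_singleton_self e⟩, ?_⟩
  change f (algebraMap k A c * e) = c
  rw [map_mul, hf, hfe, mul_one]

include hf he hfe hnil in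
/-- The kernel of `f` is the only maximal submodule of the block `A e`. -/
theorem isCoatom_block_iff (N : Submodule A (Ideal.span {e})) :
    IsCoatom N ↔ N = LinearMap.ker (blockHead f e) := by
  have hsimple : IsSimpleModule A (CharModule f) := by
    have hmax : (RingHom.ker f).IsMaximal :=
      RingHom.ker_isMaximal_of_surjective f (fun c => ⟨_, hf c⟩)
    have h2 : IsSimpleModule A (A ⧸ RingHom.ker f) :=
      isSimpleModule_iff_isCoatom.2 (Ideal.isMaximal_def.1 hmax)
    have hs : Function.Surjective (CharModule.mk f) := fun c => ⟨_, hf c⟩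
    exact IsSimpleModule.congr ((LinearMap.quotKerEquivOfSurjective (CharModule.mk f) hs).symm ≪≫ₗ
      Submodule.quotEquivOfEq _ _ (CharModule.ker_mk f))
  have hco : IsCoatom (LinearMap.ker (blockHead f e)) := by
    rw [← isSimpleModule_iff_isCoatom]
    exact IsSimpleModule.congr
      (LinearMap.quotKerEquivOfSurjective (blockHead f e) (blockHead_surjective f e hfe hf))
  refine ⟨fun hN => ?_, fun h => h ▸ hco⟩
  have hs : IsSimpleModule A (Ideal.span {e} ⧸ N) := isSimpleModule_iff_isCoatom.2 hN
  have hle : LinearMap.ker (blockHead f e) ≤ N := by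
    intro q hq
    have h0 := smul_factor_eq_zero f e he hnil (S := Ideal.span {e} ⧸ N) LinearMap.id
      Function.injective_id N.mkQ N.mkQ_surjective q.1 hq
      (N.mkQ ⟨e, Ideal.mem_span_singleton_self e⟩)
    rw [← map_smul, Submodule.mkQ_apply, Submodule.Quotient.mk_eq_zero] at h0
    convert h0
    ext
    simp only [SetLike.val_smul, smul_eq_mul]
    rw [mul_comm, mul_eq_of_mem_span e he q.2]
  rcases hco.le_iff.1 hle with h | h
  · exact absurd h hN.1
  · exact h

include hf he hfe hnil in
theorem jacobson_block :
    Module.jacobson A (Ideal.span {e}) = LinearMap.ker (blockHead f e) := by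
  have : {N : Submodule A (Ideal.span {e}) | IsCoatom N} = {LinearMap.ker (blockHead f e)} := by
    ext N
    exact isCoatom_block_iff f e he hfe hnil hf N
  rw [Module.jacobson, this, sInf_singleton]

include hf he hfe hnil in
theorem nonempty_quotient_jacobson_equiv :
    Nonempty ((Ideal.span {e} ⧸ Module.jacobson A (Ideal.span {e})) ≃ₗ[A] CharModule f) :=
  ⟨Submodule.quotEquivOfEq _ _ (jacobson_block f e he hfe hnil hf) ≪≫ₗ
    LinearMap.quotKerEquivOfSurjective _ (blockHead_surjective f e hfe hf)⟩

include hf he hfe hnil in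
theorem isIndecomposable_block : IsIndecomposable A (Ideal.span {e}) := by
  have hco := (isCoatom_block_iff f e he hfe hnil hf _).2 rfl
  have hne : Nontrivial (Ideal.span {e}) := by
    refine ⟨⟨⟨e, Ideal.mem_span_singleton_self e⟩, 0, fun h => ?_⟩⟩
    have : e = 0 := congrArg Subtype.val h
    rw [this, map_zero] at hfe
    exact zero_ne_one hfe
  refine ⟨hne, fun N N' hc => ?_⟩
  have hfin : Module.Finite A (Ideal.span {e}) :=
    Module.Finite.iff_fg.2 ⟨{e}, by simp⟩
  have key : ∀ M : Submodule A (Ideal.span {e}), M = ⊤ ∨ M ≤ LinearMap.ker (blockHead f e) := by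
    intro M
    rcases eq_top_or_exists_le_coatom M with h | ⟨L, hL, hML⟩
    · exact Or.inl h
    · exact Or.inr (hML.trans ((isCoatom_block_iff f e he hfe hnil hf L).1 hL).le)
  rcases key N with h | h
  · right
    simpa [h] using hc.inf_eq_bot
  · rcases key N' with h' | h'
    · left
      simpa [h'] using hc.inf_eq_bot
    · exact absurd (top_le_iff.1 (hc.sup_eq_top ▸ sup_le h h')) hco.1

include hf in
/-- A factor isomorphic to the module of `f` adds one to the dimension over `k`. -/
theorem finrank_of_factor_equiv {M : Type*} [AddCommGroup M] [Module A M]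
    [Module k M] [IsScalarTower k A M] [FiniteDimensional k M] (N N' : Submodule A M) (hle : N ≤ N')
    (φ : (N' ⧸ N.submoduleOf N') ≃ₗ[A] CharModule f) :
    Module.finrank k N' = Module.finrank k N + 1 := by
  let ψ : N' →ₗ[k] k :=
    { toFun := fun x => φ (Submodule.Quotient.mk x)
      map_add' := fun x y => by
        rw [Submodule.Quotient.mk_add, map_add]; rfl
      map_smul' := fun c x => by
        rw [← algebraMap_smul A c x, Submodule.Quotient.mk_smul, map_smul]
        change f (algebraMap k A c) * _ = _
        rw [hf]
        rfl }
  have hsurj : Function.Surjective ψ := by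
    intro c
    obtain ⟨x, hx⟩ := Submodule.Quotient.mk_surjective _ (φ.symm c)
    refine ⟨x, ?_⟩
    change φ (Submodule.Quotient.mk x) = c
    rw [hx]
    exact φ.apply_symm_apply c
  have hker : ∀ x : N', ψ x = 0 ↔ x.1 ∈ N := by
    intro x
    change φ (Submodule.Quotient.mk x) = 0 ↔ _
    rw [LinearEquiv.map_eq_zero_iff, Submodule.Quotient.mk_eq_zero, Submodule.submoduleOf,
      Submodule.mem_comap, Submodule.subtype_apply]
  have : FiniteDimensional k N' :=
    inferInstanceAs (FiniteDimensional k (N'.restrictScalars k))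
  have h1 := ψ.finrank_range_add_finrank_ker
  rw [LinearMap.range_eq_top.2 hsurj, finrank_top, Module.finrank_self] at h1
  have h2 : Module.finrank k (LinearMap.ker ψ) = Module.finrank k N := by
    refine LinearEquiv.finrank_eq
      { toFun := fun x => ⟨x.1.1, (hker x.1).1 x.2⟩
        invFun := fun y => ⟨⟨y.1, hle y.2⟩, (hker _).2 y.2⟩
        map_add' := fun _ _ => rfl
        map_smul' := fun _ _ => rfl
        left_inv := fun _ => rfl
        right_inv := fun _ => rfl }
  omega

instance isSimpleModule_factor {M : Type*} [AddCommGroup M] [Module A M]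
    (s : CompositionSeries (Submodule A M)) (i : Fin s.length) : IsSimpleModule A (factor s i) :=
  (covBy_iff_quot_is_simple (s.step i).le).1 (s.step i)

include hf he hnil in
theorem nonempty_factor_equiv (s : CompositionSeries (Submodule A (Ideal.span {e})))
    (i : Fin s.length) : Nonempty (factor s i ≃ₗ[A] CharModule f) :=
  nonempty_equiv_charModule_of_subquotient f e he hnil hf (S := factor s i)
    (s i.succ).subtype Subtype.val_injective (Submodule.mkQ _) (Submodule.mkQ_surjective _)

include hf he hnil in
theorem length_eq_finrank [FiniteDimensional k A]
    (s : CompositionSeries (Submodule A (Ideal.span {e}))) (hs : s.head = ⊥) (hs' : s.last = ⊤) :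
    s.length = Module.finrank k (Ideal.span {e}) := by
  have hQ : FiniteDimensional k (Ideal.span {e}) :=
    inferInstanceAs (FiniteDimensional k ((Ideal.span {e}).restrictScalars k))
  have key : ∀ i : Fin (s.length + 1), Module.finrank k (s i) = i.val := by
    intro i
    induction i using Fin.induction with
    | zero =>
      rw [show s 0 = ⊥ from hs]
      exact finrank_bot k _
    | succ i ih =>
      obtain ⟨φ⟩ := nonempty_factor_equiv f e he hnil hf s i
      rw [finrank_of_factor_equiv f hf (s i.castSucc) (s i.succ) (s.step i).le φ, ih]
      simp
  have h := key (Fin.last _)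
  rw [show s (Fin.last _) = ⊤ from hs'] at h
  rw [Fin.val_last] at h
  rw [← h]
  exact (LinearEquiv.finrank_eq
    ((Submodule.topEquiv (R := A) (M := Ideal.span {e})).restrictScalars k))

variable (k) in
include k in
theorem exists_compositionSeries_block [FiniteDimensional k A] :
    ∃ s : CompositionSeries (Submodule A (Ideal.span {e})), s.head = ⊥ ∧ s.last = ⊤ := by
  have : IsArtinianRing A := IsArtinianRing.of_finite k A
  have : IsNoetherianRing A := IsNoetherianRing.of_finite k A
  exact exists_compositionSeries_of_isNoetherian_isArtinian A _

include hf he hnil in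
theorem hasMultiplicity_block [FiniteDimensional k A] :
    HasMultiplicity A (Ideal.span {e}) (CharModule f) (Module.finrank k (Ideal.span {e})) := by
  refine ⟨exists_compositionSeries_block k e, fun s hs hs' => ?_⟩
  rw [← length_eq_finrank f e he hnil hf s hs hs']
  rw [Nat.card_congr (Equiv.subtypeUnivEquiv (nonempty_factor_equiv f e he hnil hf s))]
  simp

include hf he hfe hnil in
/-- A character `f'` vanishing on `e` does not occur in the block `A e`: the idempotent `e` acts
as the identity on the module of `f` and as zero on that of `f'`. -/
theorem hasMultiplicity_block_zero [FiniteDimensional k A] (f' : A →+* k) (hf' : f' e = 0) :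
    HasMultiplicity A (Ideal.span {e}) (CharModule f') 0 := by
  refine ⟨exists_compositionSeries_block k e, fun s _ _ => ?_⟩
  rw [Nat.card_eq_zero]
  left
  constructor
  rintro ⟨i, ⟨φ⟩⟩
  obtain ⟨ψ⟩ := nonempty_factor_equiv f e he hnil hf s i
  let θ := φ.symm ≪≫ₗ ψ
  have h1 : ∀ x : CharModule f, e • x = x := fun x => by
    change f e * (show k from x) = x
    rw [hfe]
    exact one_mul _
  have h2 : ∀ x : CharModule f', e • x = 0 := fun x => by
    change f' e * (show k from x) = (0 : k)
    rw [hf', zero_mul]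
  have h3 : θ (CharModule.mk f' 1) = 0 := by rw [← h1 (θ _), ← map_smul, h2, map_zero]
  rw [LinearEquiv.map_eq_zero_iff, CharModule.mk_apply, map_one] at h3
  exact one_ne_zero (α := k) h3

end LocalBlock

/-! ### `p'`-parts and `p'`-sections -/

section PParts

variable (p : ℕ) [Fact p.Prime] {G : Type*} [Group G] [Finite G]

variable {p} in
/-- The `p'`-part of `x * u` is `x`, for commuting elements `x` of order prime to `p` and `u` of
order a power of `p`. -/
theorem pPrimePart_mul {x u : G} (hc : Commute x u) (hx : (orderOf x).Coprime p)
    (hu : IsPElement p u) : pPrimePart p (x * u) = x := by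
  have hp : p.Prime := Fact.out
  obtain ⟨a, ha⟩ := hu
  have hcop : (orderOf x).Coprime (orderOf u) := by
    rw [ha]; exact Nat.Coprime.pow_right a hx
  have hord := hc.orderOf_mul_eq_mul_orderOf_of_coprime hcop
  have hx0 := (orderOf_pos x).ne'
  have hfac : (orderOf (x * u)).factorization p = a := by
    rw [hord, ha, Nat.factorization_mul hx0 (pow_ne_zero _ hp.ne_zero), Finsupp.add_apply,
      hp.factorization_pow, Finsupp.single_eq_same,
      Nat.factorization_eq_zero_of_not_dvd ((hp.coprime_iff_not_dvd).1 hx.symm), zero_add]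
  have h1 : ordProj[p] (orderOf (x * u)) = orderOf u := by rw [hfac, ha]
  have h2 : ordCompl[p] (orderOf (x * u)) = orderOf x := by
    rw [h1, hord, Nat.mul_div_cancel _ (orderOf_pos u)]
  unfold pPrimePart
  generalize_proofs hpf
  obtain ⟨r, hr1, hr2⟩ := Nat.chineseRemainder hpf 1 0
  change (x * u) ^ r = x
  rw [h2] at hr1
  rw [h1] at hr2
  rw [hc.mul_pow, (pow_eq_pow_iff_modEq (x := u)).2 hr2, pow_zero, mul_one]
  exact ((pow_eq_pow_iff_modEq (x := x)).2 hr1).trans (pow_one x)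

/-- Every element is the product of its `p'`-part and of a commuting `p`-element. -/
theorem exists_pPart (g : G) : (orderOf (pPrimePart p g)).Coprime p ∧
    ∃ u : G, IsPElement p u ∧ Commute (pPrimePart p g) u ∧ g = pPrimePart p g * u := by
  have hp : p.Prime := Fact.out
  have hn := (orderOf_pos g).ne'
  unfold pPrimePart
  generalize_proofs hpf
  obtain ⟨r, hr1, hr2⟩ := Nat.chineseRemainder hpf 1 0
  change (orderOf (g ^ r)).Coprime p ∧ ∃ u, IsPElement p u ∧ Commute (g ^ r) u ∧ g = g ^ r * u
  have hmul := Nat.ordProj_mul_ordCompl_eq_self (orderOf g) p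
  refine ⟨?_, (g ^ r)⁻¹ * g, ?_, ?_, by group⟩
  · have : orderOf (g ^ r) ∣ ordCompl[p] (orderOf g) := by
      rw [orderOf_dvd_iff_pow_eq_one, ← pow_mul, ← orderOf_dvd_iff_pow_eq_one]
      conv_lhs => rw [← hmul]
      exact Nat.mul_dvd_mul_right ((Nat.modEq_zero_iff_dvd).1 hr2) _
    exact (Nat.coprime_ordCompl hp hn).symm.coprime_dvd_left this
  · have h1 : ((g ^ r)⁻¹ * g) ^ (p ^ (orderOf g).factorization p) = 1 := by
      have hc : Commute (g ^ r)⁻¹ g := ((Commute.refl g).pow_left r).inv_left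
      rw [hc.mul_pow, inv_pow, inv_mul_eq_one, ← pow_mul, pow_eq_pow_iff_modEq]
      have h3 := Nat.ModEq.mul_left' (ordProj[p] (orderOf g)) hr1
      rw [hmul, mul_one, mul_comm] at h3
      exact h3
    obtain ⟨b, -, hb⟩ := (Nat.dvd_prime_pow hp).1 (orderOf_dvd_of_pow_eq_one h1)
    exact ⟨b, hb⟩
  · exact (((Commute.refl g).pow_left r).pow_right r).inv_right.mul_right
      ((Commute.refl g).pow_left r)

theorem isPElement_conj {p : ℕ} {G : Type*} [Group G] {u : G} (hu : IsPElement p u) (t : G) :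
    IsPElement p (t * u * t⁻¹) := by
  obtain ⟨a, ha⟩ := hu
  refine ⟨a, ?_⟩
  rw [← ha]
  exact orderOf_injective (MulAut.conj t).toMonoidHom (MulAut.conj t).injective u

theorem orderOf_conj {G : Type*} [Group G] (t u : G) : orderOf (t * u * t⁻¹) = orderOf u :=
  orderOf_injective (MulAut.conj t).toMonoidHom (MulAut.conj t).injective u

theorem pPrimePart_conj (t g : G) :
    pPrimePart p (t * g * t⁻¹) = t * pPrimePart p g * t⁻¹ := by
  obtain ⟨h1, u, hu, hc, hg⟩ := exists_pPart p g
  have h2 : t * g * t⁻¹ = (t * pPrimePart p g * t⁻¹) * (t * u * t⁻¹) := by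
    conv_lhs => rw [hg]
    group
  rw [h2]
  refine pPrimePart_mul ?_ ?_ (isPElement_conj hu t)
  · exact hc.map (MulAut.conj t).toMonoidHom
  · rwa [orderOf_conj]

theorem pPrimePart_eq_self {x : G} (hx : (orderOf x).Coprime p) : pPrimePart p x = x := by
  have := pPrimePart_mul (p := p) (Commute.one_right x) hx ⟨0, by simp⟩
  rwa [mul_one] at this

theorem mem_pPrimeSection_iff (C : ConjClasses G) (g : G) :
    g ∈ pPrimeSection p C ↔ ConjClasses.mk (pPrimePart p g) = C :=
  ConjClasses.mem_carrier_iff_mk_eq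

theorem mem_pPrimeSection_conj (C : ConjClasses G) {g h : G} (hgh : IsConj g h) :
    g ∈ pPrimeSection p C ↔ h ∈ pPrimeSection p C := by
  obtain ⟨t, rfl⟩ := isConj_iff.1 hgh
  simp only [mem_pPrimeSection_iff, pPrimePart_conj]
  rw [ConjClasses.mk_eq_mk_iff_isConj.2 (isConj_iff.2 ⟨t, rfl⟩ :
    IsConj (pPrimePart p g) (t * pPrimePart p g * t⁻¹))]

theorem isPElement_coe {p : ℕ} {G : Type*} [Group G] {H : Subgroup G} {u : H} :
    IsPElement p (u : G) ↔ IsPElement p u := by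
  simp only [IsPElement, Subgroup.orderOf_coe]

theorem carrier_subset_iff {G : Type*} [Group G] {X : Set G}
    (hX : ∀ g h : G, IsConj g h → g ∈ X → h ∈ X) (g : G) :
    (ConjClasses.mk g).carrier ⊆ X ↔ g ∈ X := by
  refine ⟨fun h => h ConjClasses.mem_carrier_mk, fun hg h hh => hX g h ?_ hg⟩
  rw [ConjClasses.mem_carrier_iff_mk_eq, ConjClasses.mk_eq_mk_iff_isConj] at hh
  exact hh.symm

/-- The classes in the `p'`-section of the class of `g` correspond to the classes of `p`-elements
of the centralizer of `g`, through `u ↦ g * u`. -/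
theorem numClasses_pPrimeSection (C : ConjClasses G) (hC : IsPRegularClass p C) (g : G)
    (hg : g ∈ C.carrier) : numClasses (pPrimeSection p C) =
      numClasses {h : Subgroup.centralizer {g} | IsPElement p h} := by
  have hgC : C = ConjClasses.mk g := (ConjClasses.mem_carrier_iff_mk_eq.1 hg).symm
  have hcomm : ∀ u : Subgroup.centralizer {g}, Commute g (u : G) := fun u =>
    (Subgroup.mem_centralizer_singleton_iff.1 u.2).symm
  have hS : ∀ a b : G, IsConj a b → a ∈ pPrimeSection p C → b ∈ pPrimeSection p C :=
    fun a b h => (mem_pPrimeSection_conj p C h).1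
  have hP : ∀ a b : Subgroup.centralizer {g}, IsConj a b →
      a ∈ {h : Subgroup.centralizer {g} | IsPElement p h} →
      b ∈ {h : Subgroup.centralizer {g} | IsPElement p h} := by
    intro a b hab ha
    obtain ⟨t, rfl⟩ := isConj_iff.1 hab
    exact isPElement_conj ha t
  let F : ConjClasses (Subgroup.centralizer {g}) → ConjClasses G :=
    Quotient.map (fun u => g * (u : G)) (by
      intro a b hab
      obtain ⟨t, rfl⟩ := isConj_iff.1 hab
      refine isConj_iff.2 ⟨t, ?_⟩
      have := (hcomm t).eq
      simp only [Subgroup.coe_mul, Subgroup.coe_inv]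
      rw [← mul_assoc, ← this]
      group)
  have hF : ∀ u : Subgroup.centralizer {g}, F (ConjClasses.mk u) = ConjClasses.mk (g * (u : G)) :=
    fun _ => rfl
  symm
  refine Nat.card_eq_of_bijective (fun D => ⟨F D.1, ?_⟩) ⟨?_, ?_⟩
  · obtain ⟨D, hD⟩ := D
    obtain ⟨u, rfl⟩ := ConjClasses.exists_rep D
    rw [carrier_subset_iff hP] at hD
    rw [hF, carrier_subset_iff hS]
    change pPrimePart p (g * u) ∈ C.carrier
    rw [pPrimePart_mul (hcomm u) (hC g hg) (isPElement_coe.2 hD)]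
    exact hg
  · rintro ⟨D, hD⟩ ⟨E, hE⟩ h
    obtain ⟨u, rfl⟩ := ConjClasses.exists_rep D
    obtain ⟨v, rfl⟩ := ConjClasses.exists_rep E
    rw [carrier_subset_iff hP] at hD hE
    have h2 : ConjClasses.mk (g * (u : G)) = ConjClasses.mk (g * (v : G)) :=
      congrArg Subtype.val h
    obtain ⟨t, ht⟩ := isConj_iff.1 (ConjClasses.mk_eq_mk_iff_isConj.1 h2)
    -- Comparing `p'`-parts, an element conjugating `g u` to `g v` centralizes `g`.
    have h3 := congrArg (pPrimePart p) ht
    rw [pPrimePart_conj, pPrimePart_mul (hcomm u) (hC g hg) (isPElement_coe.2 hD),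
      pPrimePart_mul (hcomm v) (hC g hg) (isPElement_coe.2 hE)] at h3
    have htg : t * g = g * t := mul_inv_eq_iff_eq_mul.1 h3
    refine Subtype.ext (ConjClasses.mk_eq_mk_iff_isConj.2 (isConj_iff.2
      ⟨⟨t, Subgroup.mem_centralizer_singleton_iff.2 htg⟩, Subtype.ext ?_⟩))
    change t * (u : G) * t⁻¹ = v
    rw [← mul_assoc, htg, mul_assoc, mul_assoc] at ht
    rw [mul_assoc]
    exact mul_left_cancel ht
  · rintro ⟨D, hD⟩
    obtain ⟨h, rfl⟩ := ConjClasses.exists_rep D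
    rw [carrier_subset_iff hS] at hD
    change pPrimePart p h ∈ C.carrier at hD
    rw [hgC, ConjClasses.mem_carrier_iff_mk_eq, ConjClasses.mk_eq_mk_iff_isConj] at hD
    obtain ⟨t, ht⟩ := isConj_iff.1 hD
    rw [← pPrimePart_conj] at ht
    obtain ⟨-, u, hu, hc, hh⟩ := exists_pPart p (t * h * t⁻¹)
    rw [ht] at hc hh
    let u' : Subgroup.centralizer {g} :=
      ⟨u, Subgroup.mem_centralizer_singleton_iff.2 hc.symm.eq⟩
    refine ⟨⟨ConjClasses.mk u', (carrier_subset_iff hP _).2 (isPElement_coe.1 hu)⟩, ?_⟩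
    refine Subtype.ext ?_
    change ConjClasses.mk (g * u) = ConjClasses.mk h
    rw [← hh]
    exact ConjClasses.mk_eq_mk_iff_isConj.2 (isConj_iff.2 ⟨t, rfl⟩).symm

end PParts

/-! ### Roots of unity in splitting fields -/

section RootsOfUnity

/-- Over a splitting field of characteristic zero for the cyclic group generated by `x` there is a
primitive root of unity of order `orderOf x`: let a generator act on the field
`K[X] / (q)`, for `q` an irreducible factor of the cyclotomic polynomial, as multiplication by the
class of `X`. This is irreducible and commutes with the action, so it is a scalar. -/
theorem exists_primitiveRoot {K G : Type*} [Field K] [CharZero K] [Group G] [Finite G] (x : G)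
    (hK : IsSplittingField K (Subgroup.zpowers x)) : ∃ ζ : K, IsPrimitiveRoot ζ (orderOf x) := by
  have hn : 0 < orderOf x := orderOf_pos x
  set n := orderOf x
  obtain ⟨q, hq, hqdvd⟩ := Polynomial.exists_irreducible_of_natDegree_pos
    (f := Polynomial.cyclotomic n K)
    (by rw [Polynomial.natDegree_cyclotomic]; exact Nat.totient_pos.2 hn)
  have : Fact (Irreducible q) := ⟨hq⟩
  let L := AdjoinRoot q
  let z : L := AdjoinRoot.root q
  have hL : FiniteDimensional K L := (AdjoinRoot.powerBasis hq.ne_zero).finite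
  have hinj : Function.Injective (algebraMap K L) := (algebraMap K L).injective
  have : NeZero (n : L) := ⟨by
    rw [← map_natCast (algebraMap K L)]
    exact (map_ne_zero_iff _ hinj).2 (Nat.cast_ne_zero.2 hn.ne')⟩
  have hz : IsPrimitiveRoot z n := by
    rw [← Polynomial.isRoot_cyclotomic_iff, Polynomial.IsRoot.def,
      ← Polynomial.map_cyclotomic n (algebraMap K L), Polynomial.eval_map]
    obtain ⟨r, hr⟩ := hqdvd
    rw [hr, Polynomial.eval₂_mul]
    have : Polynomial.eval₂ (algebraMap K L) z q = 0 := AdjoinRoot.eval₂_root q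
    rw [this, zero_mul]
  let zu : Lˣ := (hz.isUnit hn.ne').unit
  have hzu : (zu : L) = z := rfl
  let gen : Subgroup.zpowers x := ⟨x, Subgroup.mem_zpowers x⟩
  have hgen : ∀ y : Subgroup.zpowers x, y ∈ Subgroup.zpowers gen := by
    rintro ⟨y, k, rfl⟩
    exact ⟨k, rfl⟩
  have hord : orderOf zu ∣ orderOf gen := by
    have h1 : orderOf gen = n := Subgroup.orderOf_mk x _
    rw [h1, orderOf_dvd_iff_pow_eq_one]
    ext
    simp only [Units.val_pow_eq_pow_val, hzu, hz.pow_eq_one, Units.val_one]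
  let χ : Subgroup.zpowers x →* Lˣ := monoidHomOfForallMemZpowers hgen hord
  have hχ : χ gen = zu := monoidHomOfForallMemZpowers_apply_gen hgen hord
  let ε : L ≃ₗ[K] (Fin (Module.finrank K L) → K) := (Module.finBasis K L).equivFun
  let ρ : Representation K (Subgroup.zpowers x) (Fin (Module.finrank K L) → K) :=
    { toFun := fun h => ε.conj (LinearMap.mulLeft K (χ h : L))
      map_one' := by ext; simp [LinearEquiv.conj_apply]
      map_mul' := fun a b => by
        rw [map_mul, Units.val_mul, LinearMap.mulLeft_mul]
        exact ε.conj_comp _ _ }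
  have hρ : ∀ h v, ρ h v = ε (χ h * ε.symm v) := fun _ _ => rfl
  have hirr : ρ.IsIrreducible := by
    have hne : (⊥ : Subrepresentation ρ) ≠ ⊤ := by
      intro h
      have h1 : (⊥ : Submodule K (Fin (Module.finrank K L) → K)) = ⊤ :=
        congrArg Subrepresentation.toSubmodule h
      have h2 : ε 1 ∈ (⊥ : Submodule K (Fin (Module.finrank K L) → K)) := by rw [h1]; trivial
      rw [Submodule.mem_bot, LinearEquiv.map_eq_zero_iff] at h2
      exact one_ne_zero h2
    have : Nontrivial (Subrepresentation ρ) := ⟨⟨_, _, hne⟩⟩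
    refine ⟨fun W => ?_⟩
    by_cases hW : W.toSubmodule = ⊥
    · exact Or.inl (Subrepresentation.toSubmodule_injective hW)
    · right
      apply Subrepresentation.toSubmodule_injective
      change W.toSubmodule = ⊤
      obtain ⟨w, hw, hw0⟩ := (Submodule.ne_bot_iff _).1 hW
      rw [eq_top_iff]
      rintro v -
      have hsw : ε.symm w ≠ 0 := by
        rwa [Ne, LinearEquiv.map_eq_zero_iff]
      -- A nonzero invariant subspace contains `K[z] w = L w = L`.
      have key : ∀ f : Polynomial K, ε (AdjoinRoot.mk q f * ε.symm w) ∈ W.toSubmodule := by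
        intro f
        induction f using Polynomial.induction_on with
        | C a =>
          have : AdjoinRoot.mk q (Polynomial.C a) * ε.symm w = a • ε.symm w :=
            (Algebra.smul_def a (ε.symm w)).symm
          rw [this, map_smul, LinearEquiv.apply_symm_apply]
          exact W.toSubmodule.smul_mem a hw
        | add f g hf hg =>
          rw [map_add, add_mul, map_add]
          exact W.toSubmodule.add_mem hf hg
        | monomial m a ih =>
          have h1 := W.apply_mem_toSubmodule gen ih
          rw [hρ, hχ, hzu, LinearEquiv.symm_apply_apply] at h1
          convert h1 using 2
          rw [pow_succ, ← mul_assoc, map_mul _ _ Polynomial.X, AdjoinRoot.mk_X]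
          ring
      obtain ⟨f, hf⟩ := AdjoinRoot.mk_surjective (ε.symm v * (ε.symm w)⁻¹)
      have h1 := key f
      rw [hf, inv_mul_cancel_right₀ hsw, LinearEquiv.apply_symm_apply] at h1
      exact h1
  obtain ⟨c, hc⟩ := hK _ ρ hirr (ρ gen) (fun h => by
    refine LinearMap.ext fun v => ?_
    rw [LinearMap.comp_apply, LinearMap.comp_apply, hρ, hρ, hρ, hρ, LinearEquiv.symm_apply_apply,
      LinearEquiv.symm_apply_apply, mul_left_comm])
  refine ⟨c, ?_⟩
  have h1 := LinearMap.congr_fun hc (ε 1)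
  rw [hρ, hχ, hzu, LinearEquiv.symm_apply_apply, mul_one, LinearMap.smul_apply,
    LinearMap.id_apply, ← map_smul] at h1
  have h2 : z = algebraMap K L c := by
    rw [Algebra.algebraMap_eq_smul_one]
    exact ε.injective h1
  rw [h2] at hz
  exact hz.of_map_of_injective hinj

end RootsOfUnity

/-! ### Traces of operators of finite order -/

section Idempotents

/-- An element `T` with `T ^ (m + 1) = T` of an algebra containing the `m`-th roots of unity is a
combination of idempotents, with roots of unity as coefficients. These are the polynomials
`m⁻¹ ∑ ζ⁻ʲⁱ T ^ i`, for `1 ≤ i ≤ m`, in `T`. -/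
theorem exists_idempotents_of_pow_eq {K A : Type*} [Field K] [CharZero K] [Ring A] [Algebra K A]
    {m : ℕ} (hm : 0 < m) {ζ : K} (hζ : IsPrimitiveRoot ζ m) (T : A) (hT : T ^ (m + 1) = T) :
    ∃ π : ℕ → A, (∀ j, π j * π j = π j) ∧ (∀ S j, Commute S T → Commute S (π j)) ∧
      ∀ n, T ^ (n + 1) = ∑ j ∈ Finset.range m, ζ ^ (j * (n + 1)) • π j := by
  have hζ0 : ζ ≠ 0 := hζ.ne_zero hm.ne'
  have hm0 : (m : K) ≠ 0 := Nat.cast_ne_zero.2 hm.ne'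
  let π : ℕ → A := fun j =>
    (m : K)⁻¹ • ∑ i ∈ Finset.range m, (ζ⁻¹) ^ (j * (i + 1)) • T ^ (i + 1)
  have hmul : ∀ j, π j * T = ζ ^ j • π j := by
    intro j
    have h1 : ∀ i, ζ ^ j * (ζ⁻¹) ^ (j * (i + 1)) = (ζ⁻¹) ^ (j * i) := by
      intro i
      rw [mul_add, mul_one, pow_add, mul_left_comm, ← mul_pow, mul_inv_cancel₀ hζ0, one_pow,
        mul_one]
    simp only [π, smul_mul_assoc, Finset.sum_mul]
    rw [smul_comm]
    refine congrArg _ ?_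
    rw [Finset.smul_sum]
    have h4 : ∀ i, ζ ^ j • ζ⁻¹ ^ (j * (i + 1)) • T ^ (i + 1) = ζ⁻¹ ^ (j * i) • T ^ (i + 1) :=
      fun i => by rw [smul_smul, h1]
    simp only [h4, ← pow_succ]
    -- Both sides are the sum over a full period of `i ↦ ζ⁻ʲⁱ T ^ (i + 1)`.
    have h2 := Finset.sum_range_succ (fun i => (ζ⁻¹) ^ (j * i) • T ^ (i + 1)) m
    rw [Finset.sum_range_succ'] at h2
    have h3 : (ζ⁻¹) ^ (j * m) = 1 := by
      rw [mul_comm, pow_mul, inv_pow, hζ.pow_eq_one, inv_one, one_pow]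
    rw [h3, hT] at h2
    simpa using h2
  have hpow : ∀ j n, π j * T ^ n = ζ ^ (j * n) • π j := by
    intro j n
    induction n with
    | zero => simp
    | succ n ih =>
      rw [pow_succ, ← mul_assoc, ih, smul_mul_assoc, hmul, smul_smul, ← pow_add, mul_add, mul_one]
  have hsum : T = ∑ j ∈ Finset.range m, ζ ^ j • π j := by
    have h1 : ∀ i ∈ Finset.range m, i ≠ 0 →
        ∑ j ∈ Finset.range m, ζ ^ j * (ζ⁻¹) ^ (j * (i + 1)) = 0 := by
      intro i hi hi0
      have h2 : ∀ j, ζ ^ j * (ζ⁻¹) ^ (j * (i + 1)) = (ζ⁻¹ ^ i) ^ j := by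
        intro j
        rw [mul_add, mul_one, pow_add, mul_left_comm, ← mul_pow, mul_inv_cancel₀ hζ0, one_pow,
          mul_one, ← pow_mul, mul_comm]
      simp only [h2]
      have h3 : ζ⁻¹ ^ i ≠ 1 :=
        hζ.inv.pow_ne_one_of_pos_of_lt hi0 (Finset.mem_range.1 hi)
      have h4 := geom_sum_mul (ζ⁻¹ ^ i) m
      rw [← pow_mul, mul_comm i, pow_mul, hζ.inv.pow_eq_one, one_pow, sub_self] at h4
      exact (mul_eq_zero.1 h4).resolve_right (sub_ne_zero.2 h3)
    simp only [π, smul_smul, Finset.smul_sum]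
    rw [Finset.sum_comm]
    have h5 : ∀ i ∈ Finset.range m, ∑ j ∈ Finset.range m,
        (ζ ^ j * ((m : K)⁻¹ * (ζ⁻¹) ^ (j * (i + 1)))) • T ^ (i + 1) =
          if i = 0 then T else 0 := by
      intro i hi
      have h6 : ∀ j, ζ ^ j * ((m : K)⁻¹ * (ζ⁻¹) ^ (j * (i + 1))) =
          (m : K)⁻¹ * (ζ ^ j * (ζ⁻¹) ^ (j * (i + 1))) := fun j => by ring
      simp only [h6]
      rw [← Finset.sum_smul, ← Finset.mul_sum]
      split_ifs with h
      · subst h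
        have h7 : ∀ j, ζ ^ j * (ζ⁻¹) ^ (j * (0 + 1)) = 1 := fun j => by
          rw [zero_add, mul_one, ← mul_pow, mul_inv_cancel₀ hζ0, one_pow]
        simp only [h7]
        simp [hm0]
      · rw [h1 i hi h, mul_zero, zero_smul]
    rw [Finset.sum_congr rfl h5, Finset.sum_ite_eq' , if_pos (Finset.mem_range.2 hm)]
  refine ⟨π, fun j => ?_, fun S j hS => ?_, fun n => ?_⟩
  · conv_lhs => enter [2]; simp only [π]
    rw [mul_smul_comm, Finset.mul_sum]
    have h1 : ∀ i, ζ⁻¹ ^ (j * (i + 1)) * ζ ^ (j * (i + 1)) = 1 := fun i => by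
      rw [← mul_pow, inv_mul_cancel₀ hζ0, one_pow]
    simp only [mul_smul_comm, hpow, smul_smul, h1, one_smul]
    rw [Finset.sum_const, Finset.card_range, ← Nat.cast_smul_eq_nsmul K, smul_smul,
      inv_mul_cancel₀ hm0, one_smul]
  · exact (Commute.sum_right _ _ _ fun i _ => (hS.pow_right _).smul_right _).smul_right _
  · rw [pow_succ']
    conv_lhs => rw [hsum]
    rw [Finset.sum_mul]
    refine Finset.sum_congr rfl fun j _ => ?_
    rw [smul_mul_assoc, ← hsum, hpow, smul_smul, ← pow_add]
    congr 2
    ring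

/-- The character of the subrepresentation cut out by an idempotent intertwiner `π` is
`g ↦ tr (ρ g ∘ π)`. -/
theorem trace_mul_idempotent_mem_characters {K G V : Type*} [Field K] [Group G] [AddCommGroup V]
    [Module K V] [FiniteDimensional K V] (ρ : Representation K G V) (π : Module.End K V)
    (hπ : π * π = π) (hc : ∀ g, Commute (ρ g) π) :
    (fun g => LinearMap.trace K V (ρ g * π)) ∈ characters K G := by
  let W : Subrepresentation ρ :=
    { toSubmodule := LinearMap.range π
      apply_mem_toSubmodule := by
        rintro g _ ⟨v, rfl⟩
        exact ⟨ρ g v, (LinearMap.congr_fun (hc g).eq v).symm⟩ }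
  convert character_mem W.toRepresentation using 1
  funext g
  have h1 : ρ g * π = (ρ g ∘ₗ W.toSubmodule.subtype) ∘ₗ π.rangeRestrict := rfl
  rw [h1, LinearMap.trace_comp_comm']
  change _ = LinearMap.trace K _ (W.toRepresentation g)
  congr 1
  ext ⟨_, v, rfl⟩
  change π (ρ g (π v)) = ρ g (π v)
  have h2 := LinearMap.congr_fun (hc g).eq v
  change ρ g (π v) = π (ρ g v) at h2
  rw [h2]
  exact LinearMap.congr_fun hπ (ρ g v)

/-- If `T` commutes with the representation `ρ` and `T ^ (m + 1) = T` then the function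
`g ↦ tr (ρ g ∘ T)` is a combination of characters with `m`-th roots of unity as coefficients. -/
theorem exists_charRing_trace_mul {K G V : Type*} [Field K] [CharZero K] [Group G]
    [AddCommGroup V] [Module K V] [FiniteDimensional K V] (ρ : Representation K G V) {m : ℕ}
    (hm : 0 < m) {ζ : K} (hζ : IsPrimitiveRoot ζ m) (T : Module.End K V) (hT : T ^ (m + 1) = T)
    (hc : ∀ g, Commute (ρ g) T) : ∃ χ : ℕ → charRing K G, (∀ j, (χ j).1 ∈ characters K G) ∧
      ∀ g, LinearMap.trace K V (ρ g * T) = ∑ j ∈ Finset.range m, ζ ^ j * (χ j).1 g := by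
  obtain ⟨π, h1, h2, h3⟩ := exists_idempotents_of_pow_eq hm hζ T hT
  have h4 : ∀ j, (fun g => LinearMap.trace K V (ρ g * π j)) ∈ characters K G := fun j =>
    trace_mul_idempotent_mem_characters ρ (π j) (h1 j) fun g => h2 _ j (hc g)
  refine ⟨fun j => ⟨_, AddSubgroup.subset_closure (h4 j)⟩, h4, fun g => ?_⟩
  have h5 := h3 0
  simp only [zero_add, pow_one, mul_one] at h5
  conv_lhs => rw [h5]
  rw [Finset.mul_sum, map_sum]
  refine Finset.sum_congr rfl fun j _ => ?_
  rw [mul_smul_comm, map_smul, smul_eq_mul]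

/-- The values of a character at the powers of `g`, through the eigenvalue multiplicities of
`ρ g`. -/
theorem exists_multiplicities {K G : Type*} [Field K] [CharZero K] [Group G] [Finite G] (g : G)
    {ζ : K} (hζ : IsPrimitiveRoot ζ (orderOf g)) {χ : G → K} (hχ : χ ∈ characters K G) :
    ∃ d : ℕ → ℕ, ∀ n, χ (g ^ (n + 1)) =
      ∑ j ∈ Finset.range (orderOf g), ζ ^ (j * (n + 1)) * d j := by
  obtain ⟨N, ρ, rfl⟩ := hχ
  obtain ⟨π, h1, -, h3⟩ := exists_idempotents_of_pow_eq (orderOf_pos g) hζ (ρ g)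
    (by rw [← map_pow, pow_succ, pow_orderOf_eq_one, one_mul])
  refine ⟨fun j => Module.finrank K (LinearMap.range (π j)), fun n => ?_⟩
  rw [Representation.character, map_pow, h3, map_sum]
  refine Finset.sum_congr rfl fun j _ => ?_
  rw [map_smul, smul_eq_mul,
    (LinearMap.IsIdempotentElem.isProj_range (π j) (h1 j)).trace]

end Idempotents

/-! ### Induced class functions through translation operators -/

section Translations

variable (K : Type*) [Field K] (G : Type*) [Group G]

/-- The action of `G` on the functions `G → K` by left translations. -/
def leftTranslation : Representation K G (G → K) where
  toFun g := LinearMap.funLeft K K fun t => g⁻¹ * t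
  map_one' := by ext; simp
  map_mul' g h := by ext; simp [mul_assoc]

/-- The action of `G` on the functions `G → K` by right translations. -/
def rightTranslation : Representation K G (G → K) where
  toFun h := LinearMap.funLeft K K fun t => t * h
  map_one' := by ext; simp
  map_mul' g h := by ext; simp [mul_assoc]

variable {K G}

theorem leftTranslation_apply (g : G) (φ : G → K) (t : G) :
    leftTranslation K G g φ t = φ (g⁻¹ * t) := rfl

theorem rightTranslation_apply (h : G) (φ : G → K) (t : G) :
    rightTranslation K G h φ t = φ (t * h) := rfl

theorem commute_leftTranslation_rightTranslation (g h : G) :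
    Commute (leftTranslation K G g) (rightTranslation K G h) := by
  refine LinearMap.ext fun φ => funext fun t => ?_
  simp only [Module.End.mul_apply, leftTranslation_apply, rightTranslation_apply, mul_assoc]

open Classical in
theorem trace_leftTranslation_mul_rightTranslation [Fintype G] (g h : G) :
    LinearMap.trace K (G → K) (leftTranslation K G g * rightTranslation K G h) =
      ∑ t : G, if t⁻¹ * g * t = h then 1 else 0 := by
  rw [LinearMap.trace_eq_matrix_trace K (Pi.basisFun K G), Matrix.trace]
  refine Finset.sum_congr rfl fun t _ => ?_
  rw [Matrix.diag_apply, LinearMap.toMatrix_apply, Pi.basisFun_repr, Pi.basisFun_apply,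
    Module.End.mul_apply, leftTranslation_apply, rightTranslation_apply, Pi.single_apply]
  refine if_congr ?_ rfl rfl
  rw [mul_assoc, mul_assoc, inv_mul_eq_iff_eq_mul, inv_mul_eq_iff_eq_mul, eq_comm]

/-- For `x` of order `m` centralizing a subgroup `Q`, the function
`g ↦ |Q|⁻¹ * #{t | t⁻¹ g t ∈ x Q}`, which is a multiple of the function induced from the
characteristic function of `x Q` on `⟨x⟩ Q`, is a combination of characters with `m`-th roots of
unity as coefficients. Indeed it is the trace of `g` followed by right translation by `x` and
averaging over `Q`, an operator `T` that commutes with left translations and satisfies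
`T ^ (m + 1) = T`. -/
theorem exists_charRing_eq_card [CharZero K] [Finite G] (x : G) (Q : Subgroup G)
    (hQ : ∀ u ∈ Q, Commute x u) {ζ : K} (hζ : IsPrimitiveRoot ζ (orderOf x)) :
    ∃ χ : ℕ → charRing K G, (∀ j, (χ j).1 ∈ characters K G) ∧
      ∀ g, (Nat.card Q : K)⁻¹ * Nat.card {t : G // x⁻¹ * (t⁻¹ * g * t) ∈ Q} =
        ∑ j ∈ Finset.range (orderOf x), ζ ^ j * (χ j).1 g := by
  classical
  have := Fintype.ofFinite G
  let A : Module.End K (G → K) := (Nat.card Q : K)⁻¹ • ∑ u : Q, rightTranslation K G u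
  have hcard : (Nat.card Q : K) ≠ 0 := Nat.cast_ne_zero.2 Nat.card_pos.ne'
  have hRA : ∀ u : Q, rightTranslation K G (u : G) * A = A := by
    intro u
    simp only [A, mul_smul_comm, Finset.mul_sum, ← map_mul]
    congr 1
    exact Fintype.sum_equiv (Equiv.mulLeft u) _ _ fun v => rfl
  have hAA : A * A = A := by
    conv_lhs => enter [1]; simp only [A]
    rw [smul_mul_assoc, Finset.sum_mul, Finset.sum_congr rfl fun u _ => hRA u, Finset.sum_const,
      Finset.card_univ, ← Nat.card_eq_fintype_card, ← Nat.cast_smul_eq_nsmul K, smul_smul,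
      inv_mul_cancel₀ hcard, one_smul]
  have hxA : Commute (rightTranslation K G x) A :=
    (Commute.sum_right _ _ _ fun (u : Q) _ => (hQ u u.2).map (rightTranslation K G)).smul_right _
  have hT : (rightTranslation K G x * A) ^ (orderOf x + 1) = rightTranslation K G x * A := by
    rw [hxA.mul_pow, ← map_pow, pow_succ x, pow_orderOf_eq_one, one_mul,
      (show IsIdempotentElem A from hAA).pow_succ_eq]
  have hc : ∀ g, Commute (leftTranslation K G g) (rightTranslation K G x * A) := fun g =>
    (commute_leftTranslation_rightTranslation g x).mul_right
      ((Commute.sum_right _ _ _ fun (u : Q) _ =>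
        commute_leftTranslation_rightTranslation g (u : G)).smul_right _)
  obtain ⟨χ, hχ, h⟩ := exists_charRing_trace_mul (leftTranslation K G) (orderOf_pos x) hζ _ hT hc
  refine ⟨χ, hχ, fun g => ?_⟩
  rw [← h]
  simp only [A, mul_smul_comm, Finset.mul_sum, map_smul, map_sum, smul_eq_mul, ← map_mul]
  rw [← Finset.mul_sum]
  congr 1
  simp only [trace_leftTranslation_mul_rightTranslation]
  rw [Finset.sum_comm, Nat.card_eq_fintype_card, Fintype.card_subtype, Finset.natCast_card_filter]
  refine Finset.sum_congr rfl fun t _ => ?_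
  split_ifs with ht
  · rw [Finset.sum_eq_single ⟨_, ht⟩]
    · simp
    · intro u _ hu
      rw [if_neg]
      intro h1
      refine hu (Subtype.ext ?_)
      simp only [h1, inv_mul_cancel_left]
    · simp
  · symm
    refine Finset.sum_eq_zero fun u _ => if_neg fun h1 => ht ?_
    rw [h1, inv_mul_cancel_left]
    exact u.2

/-- A class function is a combination of the functions `g ↦ #{t | t⁻¹ g t = y}`. -/
theorem card_mul_eq_sum_card [Fintype G] (w : G → K) (hw : ∀ g h, IsConj g h → w g = w h) (g : G) :
    (Nat.card G : K) * w g = ∑ y : G, w y * Nat.card {t : G // t⁻¹ * g * t = y} := by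
  classical
  have h1 : ∀ y : G, (Nat.card {t : G // t⁻¹ * g * t = y} : K) =
      ∑ t : G, if t⁻¹ * g * t = y then 1 else 0 := by
    intro y
    rw [Nat.card_eq_fintype_card, Fintype.card_subtype, Finset.natCast_card_filter]
  simp only [h1, Finset.mul_sum]
  rw [Finset.sum_comm]
  simp only [mul_ite, mul_one, mul_zero, Finset.sum_ite_eq, Finset.mem_univ, if_true]
  have h2 : ∀ t : G, w (t⁻¹ * g * t) = w g := fun t =>
    (hw _ _ (isConj_iff.2 ⟨t⁻¹, by rw [inv_inv]⟩)).symm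
  simp [h2]

/-- The case of the trivial subgroup: `g ↦ #{t | t⁻¹ g t = x}` is a nonzero multiple of the
characteristic function of the class of `x`. -/
theorem exists_charRing_eq_card_conj [CharZero K] [Finite G] (x : G) {ζ : K}
    (hζ : IsPrimitiveRoot ζ (orderOf x)) :
    ∃ χ : ℕ → charRing K G, (∀ j, (χ j).1 ∈ characters K G) ∧
      ∀ g, (Nat.card {t : G // t⁻¹ * g * t = x} : K) =
        ∑ j ∈ Finset.range (orderOf x), ζ ^ j * (χ j).1 g := by
  obtain ⟨χ, hχ, h⟩ := exists_charRing_eq_card x ⊥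
    (fun u hu => by rw [Subgroup.mem_bot.1 hu]; exact Commute.one_right x) hζ
  refine ⟨χ, hχ, fun g => ?_⟩
  rw [← h g, Subgroup.card_bot, Nat.cast_one, inv_one, one_mul]
  simp only [Subgroup.mem_bot, inv_mul_eq_one, eq_comm]

/-- Over a splitting field of characteristic zero, class functions are combinations of
characters. -/
theorem mem_span_charRing [CharZero K] [Finite G]
    (hK : ∀ H : Subgroup G, IsSplittingField K H) (w : G → K)
    (hw : ∀ g h, IsConj g h → w g = w h) :
    w ∈ Submodule.span K (charRing K G : Set (G → K)) := by
  have := Fintype.ofFinite G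
  have hcard : (Nat.card G : K) ≠ 0 := Nat.cast_ne_zero.2 Nat.card_pos.ne'
  have h1 : ∀ y : G, (fun g => (Nat.card {t : G // t⁻¹ * g * t = y} : K)) ∈
      Submodule.span K (charRing K G : Set (G → K)) := by
    intro y
    obtain ⟨ζ, hζ⟩ := exists_primitiveRoot y (hK _)
    obtain ⟨χ, -, hχ⟩ := exists_charRing_eq_card_conj y hζ
    have h2 : (fun g => (Nat.card {t : G // t⁻¹ * g * t = y} : K)) =
        ∑ j ∈ Finset.range (orderOf y), ζ ^ j • (χ j).1 := by
      funext g
      rw [hχ, Finset.sum_apply]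
      rfl
    rw [h2]
    exact Submodule.sum_mem _ fun j _ =>
      Submodule.smul_mem _ _ (Submodule.subset_span (χ j).2)
  have h2 : w = (Nat.card G : K)⁻¹ •
      ∑ y : G, w y • fun g => (Nat.card {t : G // t⁻¹ * g * t = y} : K) := by
    funext g
    rw [Pi.smul_apply, Finset.sum_apply, smul_eq_mul, eq_inv_mul_iff_mul_eq₀ hcard,
      card_mul_eq_sum_card w hw]
    rfl
  rw [h2]
  exact Submodule.smul_mem _ _ (Submodule.sum_mem _ fun y _ => Submodule.smul_mem _ _ (h1 y))

end Translations

/-! ### Integrality of the scalar product and the structure of the character ring -/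

section Pairing

variable {K G : Type*} [Field K] [CharZero K] [Group G] [Fintype G]

/-- The scalar product of a virtual character with a character is an integer. -/
theorem exists_int_pairing (f : charRing K G) {χ : G → K} (hχ : χ ∈ characters K G) :
    ∃ n : ℤ, (n : K) = (Nat.card G : K)⁻¹ * ∑ g, f.1 g * χ g⁻¹ := by
  have hinv : Invertible (Nat.card G : K) :=
    invertibleOfNonzero (Nat.cast_ne_zero.2 Nat.card_pos.ne')
  obtain ⟨N, ρ, rfl⟩ := hχ
  refine AddSubgroup.closure_induction
    (p := fun x _ => ∃ n : ℤ, (n : K) = (Nat.card G : K)⁻¹ * ∑ g, x g * ρ.character g⁻¹)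
    ?_ ?_ ?_ ?_ f.2
  · rintro _ ⟨M, σ, rfl⟩
    rw [Representation.card_inv_mul_sum_char_mul_char_eq_finrank ρ σ]
    exact ⟨_, Int.cast_natCast _⟩
  · exact ⟨0, by simp⟩
  · rintro x y _ _ ⟨n, hn⟩ ⟨m, hm⟩
    refine ⟨n + m, ?_⟩
    simp only [Int.cast_add, hn, hm, Pi.add_apply, add_mul, Finset.sum_add_distrib, mul_add]
  · rintro x _ ⟨n, hn⟩
    refine ⟨-n, ?_⟩
    simp only [Int.cast_neg, hn, Pi.neg_apply, neg_mul, Finset.sum_neg_distrib, mul_neg]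

/-- Virtual characters are separated by finitely many integral functionals, the scalar products
with suitable characters, which extend linearly to all functions. -/
theorem exists_int_embedding (hK : ∀ H : Subgroup G, IsSplittingField K H) :
    ∃ (Φ : charRing K G →ₗ[ℤ] (G × Fin (Nat.card G) → ℤ))
      (Ψ : (G → K) →ₗ[K] (G × Fin (Nat.card G) → K)),
      (∀ f i, (Φ f i : K) = Ψ f.1 i) ∧ Function.Injective Φ := by
  have hcard : (Nat.card G : K) ≠ 0 := Nat.cast_ne_zero.2 Nat.card_pos.ne'
  -- The characters `χ y j` span the class functions, so a virtual character orthogonal to all of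
  -- them vanishes.
  choose ζ hζ using fun y : G => exists_primitiveRoot y (hK _)
  choose χ hχ hχ' using fun y : G => exists_charRing_eq_card_conj y (hζ y)
  choose n hn using fun (f : charRing K G) (y : G) (j : ℕ) => exists_int_pairing f (hχ y j)
  let Ψ : (G → K) →ₗ[K] (G × Fin (Nat.card G) → K) :=
    { toFun := fun f i => (Nat.card G : K)⁻¹ * ∑ g, f g * (χ i.1 i.2).1 g⁻¹
      map_add' := fun f f' => by
        funext i
        simp only [Pi.add_apply, add_mul, Finset.sum_add_distrib, mul_add]
      map_smul' := fun c f => by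
        funext i
        simp only [Pi.smul_apply, smul_eq_mul, RingHom.id_apply, mul_assoc, ← Finset.mul_sum]
        ring }
  have hΨ : ∀ (f : charRing K G) i, (n f i.1 i.2 : K) = Ψ f.1 i := fun f i => hn f i.1 i.2
  let Φ : charRing K G →+ (G × Fin (Nat.card G) → ℤ) :=
    AddMonoidHom.mk' (fun f i => n f i.1 i.2) fun f f' => by
      funext i
      apply Int.cast_injective (α := K)
      rw [Pi.add_apply, Int.cast_add, hΨ, hΨ, hΨ]
      exact congrFun (map_add Ψ f.1 f'.1) i
  refine ⟨Φ.toIntLinearMap, Ψ, hΨ, ?_⟩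
  change Function.Injective Φ
  rw [injective_iff_map_eq_zero]
  intro f hf
  have h1 : ∀ (y : G) (j), j ∈ Finset.range (orderOf y) → ∑ g, f.1 g * (χ y j).1 g⁻¹ = 0 := by
    intro y j hj
    have hj' : j < Nat.card G := (Finset.mem_range.1 hj).trans_le (orderOf_le_card (x := y))
    have h2 := hn f y j
    have h3 : n f y j = 0 := congrFun hf (y, ⟨j, hj'⟩)
    rw [h3, Int.cast_zero, zero_eq_mul] at h2
    exact h2.resolve_left (inv_ne_zero hcard)
  have h2 : ∀ y : G, ∑ g, f.1 g * (Nat.card {t : G // t⁻¹ * g⁻¹ * t = y} : K) = 0 := by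
    intro y
    simp only [hχ', Finset.mul_sum]
    rw [Finset.sum_comm]
    refine Finset.sum_eq_zero fun j hj => ?_
    simp only [mul_left_comm _ (ζ y ^ j)]
    rw [← Finset.mul_sum, h1 y j hj, mul_zero]
  apply Subtype.ext
  funext y
  have h3 := card_mul_eq_sum_card f.1 (fun g h => charRing_conj f) y
  have h4 : ∀ g, Nat.card {t : G // t⁻¹ * y * t = g} =
      Nat.card {t : G // t⁻¹ * g⁻¹ * t = y⁻¹} := by
    intro g
    refine Nat.card_congr ((Equiv.inv G).subtypeEquiv fun t => ?_)
    simp only [Equiv.inv_apply, inv_inv]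
    constructor
    · rintro rfl; group
    · intro h
      have h5 : g = t⁻¹ * (y⁻¹)⁻¹ * t := by rw [← h]; group
      rw [h5, inv_inv]
  simp only [h4, h2 y⁻¹] at h3
  exact (mul_eq_zero.1 h3).resolve_left hcard

theorem finite_charRing (hK : ∀ H : Subgroup G, IsSplittingField K H) :
    Module.Finite ℤ (charRing K G) := by
  obtain ⟨Φ, -, -, h⟩ := exists_int_embedding hK
  exact Module.Finite.of_injective Φ h

theorem free_charRing (hK : ∀ H : Subgroup G, IsSplittingField K H) :
    Module.Free ℤ (charRing K G) := by
  obtain ⟨Φ, -, -, h⟩ := exists_int_embedding hK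
  exact Module.Free.of_equiv (LinearEquiv.ofInjective Φ h).symm

end Pairing

/-! ### Elements of `R ⊗ R(G)` as functions -/

section ScalarExtension

variable {R K G : Type*} [CommRing R] [Field K] [Group G]

theorem ScalarCharRing.induction {motive : ScalarCharRing R K G → Prop} (h0 : motive 0)
    (ht : ∀ a χ, motive (tensor a χ)) (ha : ∀ b c, motive b → motive c → motive (b + c)) (b) :
    motive b :=
  TensorProduct.induction_on (motive := motive) b h0 ht ha

theorem algebraMap_eq_tensor (a : R) : algebraMap R (ScalarCharRing R K G) a = tensor a 1 := rfl

/-- The function on `G` defined by an element of `R ⊗ R(G)`, for a ring homomorphism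
`φ : R → K`. -/
noncomputable def scalarFunctions (φ : R →+* K) : ScalarCharRing R K G →+* (G → K) :=
  liftScalars (G → K) ((Pi.constRingHom G K).comp φ) (charRing K G).subtype

theorem scalarFunctions_tensor (φ : R →+* K) (a : R) (χ : charRing K G) :
    scalarFunctions φ (tensor a χ) = φ a • χ.1 := by
  rw [scalarFunctions, liftScalars_tensor]
  rfl

theorem scalarFunctions_smul (φ : R →+* K) (a : R) (b : ScalarCharRing R K G) :
    scalarFunctions φ (a • b) = φ a • scalarFunctions φ b := by
  rw [Algebra.smul_def, map_mul, algebraMap_eq_tensor, scalarFunctions_tensor]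
  funext g
  exact congrArg (· * scalarFunctions φ b g) (mul_one (φ a))

/-- For a subring `R` of `K`, the elements of `R ⊗ R(G)` are determined by the functions that they
define: `R` is flat over `ℤ`, and `R(G)` embeds into some `ℤ ^ n` by scalar products. -/
theorem scalarFunctions_injective [IsDomain R] [CharZero R] [CharZero K] [Finite G]
    (hK : ∀ H : Subgroup G, IsSplittingField K H) (φ : R →+* K) (hφ : Function.Injective φ) :
    Function.Injective (scalarFunctions (G := G) φ) := by
  have := Fintype.ofFinite G
  classical
  obtain ⟨Φ, Ψ, hΦΨ, hΦ⟩ := exists_int_embedding hK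
  rw [injective_iff_map_eq_zero]
  intro b hb
  have hinj : Function.Injective (LinearMap.lTensor R Φ) :=
    Module.Flat.lTensor_preserves_injective_linearMap Φ hΦ
  let θ : ScalarCharRing R K G →+ (G × Fin (Nat.card G) → R) :=
    ((TensorProduct.piScalarRight ℤ ℤ R (G × Fin (Nat.card G))).toLinearMap ∘ₗ
      LinearMap.lTensor R Φ).toAddMonoidHom
  have hθt : ∀ a χ i, θ (tensor a χ) i = Φ χ i • a := fun a χ i => rfl
  have key : ∀ (b : ScalarCharRing R K G) i, φ (θ b i) =
      Ψ (scalarFunctions φ b) i := by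
    intro b i
    induction b using ScalarCharRing.induction with
    | h0 => simp
    | ht a χ =>
      rw [scalarFunctions_tensor, hθt, zsmul_eq_mul, map_mul, map_intCast, hΦΨ, map_smul,
        Pi.smul_apply, smul_eq_mul, mul_comm]
    | ha b c hb hc => rw [map_add, map_add, map_add, Pi.add_apply, Pi.add_apply, map_add, hb, hc]
  have h0 : θ b = 0 := by
    funext i
    apply hφ
    rw [key, hb, map_zero, Pi.zero_apply, Pi.zero_apply, map_zero]
  refine hinj (Eq.trans ?_ (map_zero (LinearMap.lTensor R Φ)).symm)
  exact (LinearEquiv.map_eq_zero_iff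
    (TensorProduct.piScalarRight ℤ ℤ R (G × Fin (Nat.card G)))).1 h0

end ScalarExtension

/-! ### Reduction of the ideal generated by an idempotent -/

section IdempotentRank

variable {R B : Type*} [CommRing R] [CommRing B] [Algebra R B]

/-- Multiplication by `e`, as a map onto the ideal generated by `e`. -/
def mulToSpan (R : Type*) {B : Type*} [CommRing R] [CommRing B] [Algebra R B] (e : B) :
    B →ₗ[R] Ideal.span {e} :=
  (LinearMap.toSpanSingleton B (Ideal.span {e})
    ⟨e, Ideal.mem_span_singleton_self e⟩).restrictScalars R

theorem coe_mulToSpan (e b : B) : (mulToSpan R e b : B) = b * e := rfl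

theorem mulToSpan_coe {e : B} (he : e * e = e) (q : Ideal.span {e}) : mulToSpan R e q = q := by
  ext
  rw [coe_mulToSpan, mul_comm, mul_eq_of_mem_span e he q.2]

theorem finite_span_singleton [Module.Finite R B] (e : B) :
    Module.Finite R (Ideal.span {e}) := by
  refine Module.Finite.of_surjective (mulToSpan R e) ?_
  rintro ⟨q, hq⟩
  obtain ⟨a, rfl⟩ := Ideal.mem_span_singleton'.1 hq
  exact ⟨a, rfl⟩

theorem free_span_idempotent [IsLocalRing R] [Module.Finite R B] [Module.Free R B] {e : B}
    (he : e * e = e) : Module.Free R (Ideal.span {e}) := by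
  have := finite_span_singleton (R := R) e
  have : Module.Projective R (Ideal.span {e}) :=
    Module.Projective.of_split ((Submodule.subtype _).restrictScalars R) (mulToSpan R e)
      (LinearMap.ext fun q => mulToSpan_coe (R := R) he q)
  exact Module.free_of_flat_of_isLocalRing

/-- The rank of the ideal generated by an idempotent is unchanged by reduction modulo the
maximal ideal of the base ring. -/
theorem finrank_span_map_idempotent {k A : Type*} [IsLocalRing R] [Module.Finite R B]
    [Module.Free R B] [Field k] [CommRing A] [Algebra k A] (π : R →+* k)
    (hπ : Function.Surjective π) (red : B →+* A) (hred : Function.Surjective red)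
    (hsmul : ∀ (a : R) b, red (a • b) = π a • red b)
    (hker : ∀ b, red b = 0 → b ∈ RingHom.ker π • (⊤ : Submodule R B)) {e : B} (he : e * e = e) :
    Module.finrank k (Ideal.span {red e}) = Module.finrank R (Ideal.span {e}) := by
  have := finite_span_singleton (R := R) e
  have := free_span_idempotent (R := R) he
  let v := Module.Free.chooseBasis R (Ideal.span {e})
  have hmem : ∀ q : Ideal.span {e}, red q ∈ Ideal.span {red e} := by
    rintro ⟨q, hq⟩
    obtain ⟨a, rfl⟩ := Ideal.mem_span_singleton'.1 hq
    exact Ideal.mem_span_singleton'.2 ⟨red a, (map_mul red a e).symm⟩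
  let v' : Module.Free.ChooseBasisIndex R (Ideal.span {e}) → Ideal.span {red e} :=
    fun i => ⟨red (v i), hmem _⟩
  have hcomb : ∀ c : Module.Free.ChooseBasisIndex R (Ideal.span {e}) → R,
      red (∑ i, c i • v i : Ideal.span {e}) = (∑ i, π (c i) • v' i : Ideal.span {red e}) := by
    intro c
    simp only [Submodule.coe_sum, map_sum]
    exact Finset.sum_congr rfl fun i _ => hsmul _ _
  have hli : LinearIndependent k v' := by
    rw [Fintype.linearIndependent_iff]
    intro c hc i
    choose d hd using fun i => hπ (c i)
    have h1 := hcomb d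
    simp only [hd, hc] at h1
    have h2 := hker _ h1
    -- The coordinate extends to `B` through multiplication by `e`, so it maps `ker π • B` to
    -- `ker π`.
    let l : B →ₗ[R] R := v.coord i ∘ₗ mulToSpan R e
    have h3 : l (∑ i, d i • v i : Ideal.span {e}) ∈
        (RingHom.ker π • (⊤ : Submodule R B)).map l := Submodule.mem_map_of_mem h2
    rw [Submodule.map_smul''] at h3
    have h4 := Submodule.smul_mono (le_refl (RingHom.ker π)) (le_top : _ ≤ (⊤ : Submodule R R)) h3
    rw [smul_eq_mul, Ideal.mul_top, RingHom.mem_ker] at h4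
    rw [← hd i, ← h4]
    congr 1
    simp only [l, LinearMap.comp_apply, mulToSpan_coe he, Module.Basis.coord_apply,
      Module.Basis.repr_sum_self]
  have hsp : ⊤ ≤ Submodule.span k (Set.range v') := by
    rintro ⟨q, hq⟩ -
    obtain ⟨a, rfl⟩ := Ideal.mem_span_singleton'.1 hq
    obtain ⟨b, rfl⟩ := hred a
    have h1 := hcomb (v.repr (mulToSpan R e b))
    rw [v.sum_repr, coe_mulToSpan, map_mul] at h1
    rw [show (⟨red b * red e, hq⟩ : Ideal.span {red e}) = _ from Subtype.ext h1]
    exact Submodule.sum_mem _ fun i _ =>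
      Submodule.smul_mem _ _ (Submodule.subset_span ⟨i, rfl⟩)
  rw [Module.finrank_eq_card_basis v, Module.finrank_eq_card_basis (Module.Basis.mk hli hsp)]

end IdempotentRank

/-! ### Class functions supported on a union of classes -/

section ClassFunctions

variable (K : Type*) [Field K] {G : Type*} [Group G]

open Classical in
/-- Functions on the set of classes contained in `S`, as functions on `G`. -/
noncomputable def classFunctionsOn (S : Set G) :
    ({D : ConjClasses G // D.carrier ⊆ S} → K) →ₗ[K] (G → K) where
  toFun c g := if h : (ConjClasses.mk g).carrier ⊆ S then c ⟨ConjClasses.mk g, h⟩ else 0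
  map_add' c d := by
    funext g
    simp only [Pi.add_apply]
    split_ifs <;> simp
  map_smul' a c := by
    funext g
    simp only [Pi.smul_apply, RingHom.id_apply]
    split_ifs <;> simp

variable {K}

theorem classFunctionsOn_injective (S : Set G) :
    Function.Injective (classFunctionsOn K S) := by
  rw [injective_iff_map_eq_zero]
  intro c hc
  funext ⟨D, hD⟩
  obtain ⟨g, rfl⟩ := ConjClasses.exists_rep D
  have h1 := congrFun hc g
  simp only [classFunctionsOn, LinearMap.coe_mk, AddHom.coe_mk] at h1
  rwa [dif_pos hD] at h1

theorem mem_range_classFunctionsOn {S : Set G} (hS : ∀ g h : G, IsConj g h → g ∈ S → h ∈ S)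
    (w : G → K) : w ∈ LinearMap.range (classFunctionsOn K S) ↔
      (∀ g h, IsConj g h → w g = w h) ∧ ∀ g, g ∉ S → w g = 0 := by
  constructor
  · rintro ⟨c, rfl⟩
    refine ⟨fun g h hgh => ?_, fun g hg => ?_⟩
    · simp only [classFunctionsOn, LinearMap.coe_mk, AddHom.coe_mk]
      rw [ConjClasses.mk_eq_mk_iff_isConj.2 hgh]
    · simp only [classFunctionsOn, LinearMap.coe_mk, AddHom.coe_mk]
      rw [dif_neg (fun h => hg ((carrier_subset_iff hS g).1 h))]
  · rintro ⟨h1, h2⟩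
    refine ⟨fun D => w (Quotient.out D.1), ?_⟩
    funext g
    simp only [classFunctionsOn, LinearMap.coe_mk, AddHom.coe_mk]
    split_ifs with h
    · exact h1 _ _ (ConjClasses.mk_eq_mk_iff_isConj.1 (Quotient.out_eq (ConjClasses.mk g)))
    · exact (h2 g fun hg => h ((carrier_subset_iff hS g).2 hg)).symm

theorem finrank_range_classFunctionsOn [Finite G] (S : Set G) :
    Module.finrank K (LinearMap.range (classFunctionsOn K S)) = numClasses S := by
  have := Fintype.ofFinite {D : ConjClasses G // D.carrier ⊆ S}
  rw [LinearMap.finrank_range_of_inj (classFunctionsOn_injective S),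
    Module.finrank_fintype_fun_eq_card, numClasses, Nat.card_eq_fintype_card]

end ClassFunctions

/-! ### The rank of the ideal of a union of classes -/

section RankOverFractions

variable {R K G : Type*} [CommRing R] [Field K] [Group G]

instance [Module.Finite ℤ (charRing K G)] : Module.Finite R (ScalarCharRing R K G) :=
  inferInstanceAs (Module.Finite R (R ⊗[ℤ] charRing K G))

instance [Module.Free ℤ (charRing K G)] : Module.Free R (ScalarCharRing R K G) :=
  inferInstanceAs (Module.Free R (R ⊗[ℤ] charRing K G))

theorem scalarFunctions_conj (φ : R →+* K) (b : ScalarCharRing R K G) {g h : G}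
    (hgh : IsConj g h) : scalarFunctions φ b g = scalarFunctions φ b h := by
  induction b using ScalarCharRing.induction with
  | h0 => simp
  | ht a χ => rw [scalarFunctions_tensor, Pi.smul_apply, Pi.smul_apply, charRing_conj χ hgh]
  | ha b c hb hc => rw [map_add, Pi.add_apply, Pi.add_apply, hb, hc]

/-- The rank of the ideal of `R ⊗ R(G)` generated by the characteristic function of `S` is the
number of classes in `S`: over the fraction field this ideal becomes the space of class functions
supported on `S`. -/
theorem finrank_span_indicator [IsDomain R] [IsLocalRing R] [CharZero R] [CharZero K] [Algebra R K]
    [IsFractionRing R K] [Finite G] (hK : ∀ H : Subgroup G, IsSplittingField K H) (S : Set G)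
    (hS : ∀ g h : G, IsConj g h → g ∈ S → h ∈ S) {e : ScalarCharRing R K G} (he : e * e = e)
    (heS : scalarFunctions (algebraMap R K) e = S.indicator 1) :
    Module.finrank R (Ideal.span {e}) = numClasses S := by
  have := Fintype.ofFinite G
  have := finite_charRing hK
  have := free_charRing hK
  have := finite_span_singleton (R := R) e
  have := free_span_idempotent (R := R) he
  have hinj := scalarFunctions_injective hK (algebraMap R K) (IsFractionRing.injective R K)
  let F : ScalarCharRing R K G →ₗ[R] (G → K) :=
    { toFun := scalarFunctions (algebraMap R K)
      map_add' := map_add _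
      map_smul' := fun a b => by
        rw [scalarFunctions_smul, RingHom.id_apply]
        funext g
        exact (Algebra.smul_def a _).symm }
  have hF : ∀ b, F b = scalarFunctions (algebraMap R K) b := fun _ => rfl
  let v := Module.Free.chooseBasis R (Ideal.span {e})
  let w : Module.Free.ChooseBasisIndex R (Ideal.span {e}) → G → K := fun i => F (v i)
  have hw : LinearIndependent K w := by
    -- Independence over `R` gives independence over its fraction field.
    rw [← LinearIndependent.iff_fractionRing (R := R)]
    have h1 : LinearIndependent R fun i =>
        F (((Submodule.subtype (Ideal.span {e})).restrictScalars R) (v i)) :=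
      (v.linearIndependent.map' _ (LinearMap.ker_eq_bot.2 Subtype.val_injective)).map' F
        (LinearMap.ker_eq_bot.2 hinj)
    exact h1
  have hmem : ∀ q : Ideal.span {e}, F q ∈ Submodule.span K (Set.range w) := by
    intro q
    have h1 : F q = ∑ i, algebraMap R K (v.repr q i) • w i := by
      conv_lhs => rw [← v.sum_repr q]
      rw [Submodule.coe_sum, map_sum]
      refine Finset.sum_congr rfl fun i _ => ?_
      exact (map_smul F _ _).trans (algebraMap_smul K _ _).symm
    rw [h1]
    exact Submodule.sum_mem _ fun i _ => Submodule.smul_mem _ _ (Submodule.subset_span ⟨i, rfl⟩)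
  have hspan : Submodule.span K (Set.range w) = LinearMap.range (classFunctionsOn K S) := by
    apply le_antisymm
    · rw [Submodule.span_le]
      rintro _ ⟨i, rfl⟩
      rw [SetLike.mem_coe, mem_range_classFunctionsOn hS]
      refine ⟨fun g h hgh => scalarFunctions_conj _ _ hgh, fun g hg => ?_⟩
      change scalarFunctions (algebraMap R K) (v i : ScalarCharRing R K G) g = 0
      rw [← mul_eq_of_mem_span e he (v i).2, map_mul, heS, Pi.mul_apply,
        Set.indicator_of_notMem hg, zero_mul]
    · intro f hf
      obtain ⟨h1, h2⟩ := (mem_range_classFunctionsOn hS f).1 hf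
      have h3 : f = f * S.indicator 1 := by
        funext g
        by_cases hg : g ∈ S
        · simp [hg]
        · simp [hg, h2 g hg]
      rw [h3]
      refine Submodule.span_induction
        (p := fun f _ => f * S.indicator 1 ∈ Submodule.span K (Set.range w))
        ?_ ?_ ?_ ?_ (mem_span_charRing hK f h1)
      · intro χ hχ
        have h4 := hmem (mulToSpan R e (tensor 1 ⟨χ, hχ⟩))
        rw [coe_mulToSpan, hF, map_mul, heS, scalarFunctions_tensor, map_one, one_smul] at h4
        exact h4
      · rw [zero_mul]; exact zero_mem _
      · intro x y _ _ hx hy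
        rw [add_mul]; exact add_mem hx hy
      · intro a x _ hx
        rw [smul_mul_assoc]; exact Submodule.smul_mem _ _ hx
  rw [← finrank_range_classFunctionsOn (K := K), ← hspan, finrank_span_eq_card hw,
    Module.finrank_eq_card_basis v]

end RankOverFractions

/-! ### The kernel of reduction -/

section ReductionKernel

variable {R k K G : Type*} [CommRing R] [Field k] [Field K] [Group G]

theorem mapScalars_smul (π : R →+* k) (a : R) (b : ScalarCharRing R K G) :
    mapScalars K G π (a • b) = π a • mapScalars K G π b := by
  rw [Algebra.smul_def, map_mul, Algebra.smul_def, algebraMap_eq_tensor, algebraMap_eq_tensor,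
    mapScalars_tensor]

theorem mapScalars_surjective (π : R →+* k) (hπ : Function.Surjective π) :
    Function.Surjective (mapScalars K G π) := by
  intro b
  induction b using ScalarCharRing.induction with
  | h0 => exact ⟨0, map_zero _⟩
  | ht a χ =>
    obtain ⟨a, rfl⟩ := hπ a
    exact ⟨tensor a χ, mapScalars_tensor _ _ _⟩
  | ha b c hb hc =>
    obtain ⟨b, rfl⟩ := hb
    obtain ⟨c, rfl⟩ := hc
    exact ⟨b + c, map_add _ _ _⟩

/-- `R(G)` being free over `ℤ`, reduction is coefficientwise in a basis, so its kernel is generated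
by `ker π`. -/
theorem mem_smul_top_of_mapScalars_eq_zero [Module.Finite ℤ (charRing K G)]
    [Module.Free ℤ (charRing K G)] (π : R →+* k) (b : ScalarCharRing R K G)
    (hb : mapScalars K G π b = 0) :
    b ∈ RingHom.ker π • (⊤ : Submodule R (ScalarCharRing R K G)) := by
  let β := Module.Free.chooseBasis ℤ (charRing K G)
  let βR : Module.Basis _ R (ScalarCharRing R K G) := Algebra.TensorProduct.basis R β
  let βk : Module.Basis _ k (ScalarCharRing k K G) := Algebra.TensorProduct.basis k β
  have hR : ∀ a χ i, βR.repr (tensor a χ) i = (β.repr χ i : R) * a := by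
    intro a χ i
    have h1 := Algebra.TensorProduct.basis_repr_tmul (A := R) β a χ
    have h2 := DFunLike.congr_fun h1 i
    exact h2.trans (by simp [mul_comm])
  have hk : ∀ a χ i, βk.repr (tensor a χ) i = (β.repr χ i : k) * a := by
    intro a χ i
    have h1 := Algebra.TensorProduct.basis_repr_tmul (A := k) β a χ
    have h2 := DFunLike.congr_fun h1 i
    exact h2.trans (by simp [mul_comm])
  have key : ∀ (b : ScalarCharRing R K G) i,
      βk.repr (mapScalars K G π b) i = π (βR.repr b i) := by
    intro b i
    induction b using ScalarCharRing.induction with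
    | h0 => simp
    | ht a χ => rw [mapScalars_tensor, hR, hk, map_mul, map_intCast]
    | ha b c hb hc => simp only [map_add, Finsupp.add_apply, hb, hc]
  rw [← βR.sum_repr b]
  refine Submodule.sum_mem _ fun i _ => Submodule.smul_mem_smul ?_ trivial
  rw [RingHom.mem_ker, ← key, hb, map_zero, Finsupp.zero_apply]

end ReductionKernel

/-! ### Congruence between the values at `g` and at the `p'`-part of `g` -/

section Congruence

variable {O : Type*} [CommRing O] [IsDomain O] [IsIntegrallyClosed O] (P : Ideal O) [P.IsMaximal]
  {K : Type*} [Field K] [CharZero K] [Algebra O K] [IsFractionRing O K] {G : Type*} [Group G]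
  [Finite G] {p : ℕ} [Fact p.Prime] [CharP P.ResidueField p]

omit [IsDomain O] in
theorem exists_integral_primitiveRoot (hK : ∀ H : Subgroup G, IsSplittingField K H) (g : G) :
    ∃ ζ : O, IsPrimitiveRoot (algebraMap O K ζ) (orderOf g) := by
  obtain ⟨ζ, hζ⟩ := exists_primitiveRoot g (hK _)
  obtain ⟨z, rfl⟩ := IsIntegrallyClosed.isIntegral_iff.1
    ((hζ.isIntegral (orderOf_pos g)).tower_top (A := O))
  exact ⟨z, hζ⟩

/-- Modulo `𝔭`, a character value `∑ dⱼ ζʲ` is raised to the `q`-th power, `q = p ^ n`, when `g`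
is replaced by `g ^ q`. -/
theorem residue_evalAt_pow (hK : ∀ H : Subgroup G, IsSplittingField K H) (g : G) (n : ℕ)
    (f : charRing K G) : algebraMap O P.ResidueField (evalAt O K (g ^ p ^ n) f) =
      algebraMap O P.ResidueField (evalAt O K g f) ^ p ^ n := by
  obtain ⟨ζ, hζ⟩ := exists_integral_primitiveRoot (O := O) hK g
  obtain ⟨f, hf⟩ := f
  have hq : 0 < p ^ n := pow_pos (Fact.out : p.Prime).pos n
  induction hf using AddSubgroup.closure_induction with
  | mem χ hχ =>
    obtain ⟨d, hd⟩ := exists_multiplicities g hζ hχ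
    have h1 : ∀ m, 0 < m → evalAt O K (g ^ m) ⟨χ, AddSubgroup.subset_closure hχ⟩ =
        ∑ j ∈ Finset.range (orderOf g), ζ ^ (j * m) * d j := by
      intro m hm
      apply IsFractionRing.injective O K
      obtain ⟨m, rfl⟩ := Nat.exists_eq_add_of_lt hm
      rw [algebraMap_evalAt, zero_add]
      refine (hd m).trans ?_
      simp only [map_sum, map_mul, map_pow, map_natCast]
    have h2 := h1 1 one_pos
    rw [pow_one] at h2
    rw [h1 _ hq, h2, ← iterateFrobenius_def]
    simp only [map_sum, map_mul, map_pow, map_natCast, mul_one]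
    refine Finset.sum_congr rfl fun j _ => ?_
    rw [iterateFrobenius_def, ← pow_mul, mul_comm j]
  | zero =>
    have h1 : ∀ h : G, evalAt O K h ⟨0, zero_mem _⟩ = 0 := fun h => map_zero (evalAt O K h)
    rw [h1, h1, map_zero, zero_pow hq.ne']
  | add x y hx hy ihx ihy =>
    have h1 : ∀ h : G, evalAt O K h ⟨x + y, add_mem hx hy⟩ =
        evalAt O K h ⟨x, hx⟩ + evalAt O K h ⟨y, hy⟩ :=
      fun h => map_add (evalAt O K h) ⟨x, hx⟩ ⟨y, hy⟩
    rw [h1, h1, map_add, map_add, ihx, ihy, add_pow_char_pow]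
  | neg x hx ih =>
    have h1 : ∀ h : G, evalAt O K h ⟨-x, neg_mem hx⟩ = -evalAt O K h ⟨x, hx⟩ :=
      fun h => map_neg (evalAt O K h) ⟨x, hx⟩
    rw [h1, h1, map_neg, map_neg, ih, ← iterateFrobenius_def, ← iterateFrobenius_def, map_neg]

/-- Modulo `𝔭`, virtual characters take the same value at `g` and at the `p'`-part of `g`: these
elements have the same `q`-th power for a suitable power `q` of `p`. -/
theorem redEval_pPrimePart (hK : ∀ H : Subgroup G, IsSplittingField K H) (g : G) :
    redEval P K (ConjClasses.mk g) = redEval P K (ConjClasses.mk (pPrimePart p g)) := by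
  have h : (algebraMap O P.ResidueField).comp (evalAt O K g) =
      (algebraMap O P.ResidueField).comp (evalAt O K (pPrimePart p g)) := by
    ext f
    obtain ⟨-, u, ⟨n, hn⟩, hc, hg⟩ := exists_pPart p g
    have hpow : g ^ p ^ n = pPrimePart p g ^ p ^ n := by
      conv_lhs => rw [hg]
      rw [hc.mul_pow, ← hn, pow_orderOf_eq_one, mul_one]
    apply iterateFrobenius_inj P.ResidueField p n
    simp only [RingHom.comp_apply, iterateFrobenius_def]
    rw [← residue_evalAt_pow P hK, ← residue_evalAt_pow P hK, hpow]
  change liftScalars _ _ ((algebraMap O P.ResidueField).comp (evalAt O K g)) = _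
  rw [h]
  rfl

end Congruence

/-! ### Evaluation on `O_𝔭 R(G)` and nilpotent reductions -/

section LocalEvaluation

variable {O : Type*} [CommRing O] [IsDomain O] [IsIntegrallyClosed O] (P : Ideal O) [P.IsMaximal]
  {K : Type*} [Field K] [Algebra O K] [IsFractionRing O K] {G : Type*} [Group G]
  [Finite G]

variable (K) in
/-- Evaluation at `g`, as a ring homomorphism `O_𝔭 R(G) → O_𝔭`. -/
noncomputable def localEval (g : G) :
    ScalarCharRing (Localization.AtPrime P) K G →+* Localization.AtPrime P :=
  liftScalars _ (RingHom.id _) ((algebraMap O (Localization.AtPrime P)).comp (evalAt O K g))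

omit [IsDomain O] [IsIntegrallyClosed O] in
theorem localizationToFraction_algebraMap (a : O) :
    localizationToFraction P K (algebraMap O (Localization.AtPrime P) a) = algebraMap O K a :=
  IsLocalization.lift_eq _ a

theorem localEval_smul (g : G) (a : Localization.AtPrime P)
    (b : ScalarCharRing (Localization.AtPrime P) K G) :
    localEval P K g (a • b) = a * localEval P K g b := by
  rw [Algebra.smul_def, map_mul, algebraMap_eq_tensor, localEval, liftScalars_tensor, map_one,
    mul_one, RingHom.id_apply]

theorem localizationToFraction_localEval (g : G)
    (b : ScalarCharRing (Localization.AtPrime P) K G) :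
    localizationToFraction P K (localEval P K g b) = toFunctions P K G b g := by
  induction b using ScalarCharRing.induction with
  | h0 => simp
  | ht a χ =>
    rw [localEval, toFunctions, liftScalars_tensor, liftScalars_tensor, map_mul,
      RingHom.comp_apply, localizationToFraction_algebraMap, algebraMap_evalAt]
    rfl
  | ha b c hb hc => simp only [map_add, Pi.add_apply, hb, hc]

theorem residue_localEval (g : G) (b : ScalarCharRing (Localization.AtPrime P) K G) :
    IsLocalRing.residue (Localization.AtPrime P) (localEval P K g b) =
      redEval P K (ConjClasses.mk g) (reduction P K G b) := by
  induction b using ScalarCharRing.induction with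
  | h0 => simp
  | ht a χ =>
    rw [localEval, reduction, mapScalars_tensor, redEval, liftScalars_tensor, liftScalars_tensor,
      map_mul]
    rfl
  | ha b c hb hc => simp only [map_add, hb, hc]

omit [IsIntegrallyClosed O] in
/-- The embedding `O_𝔭 → K` makes `K` the fraction field of `O_𝔭`. -/
theorem isFractionRing_localization :
    letI := (localizationToFraction P K).toAlgebra
    IsFractionRing (Localization.AtPrime P) K := by
  let := (localizationToFraction P K).toAlgebra
  have : IsScalarTower O (Localization.AtPrime P) K :=
    IsScalarTower.of_algebraMap_eq fun a => (localizationToFraction_algebraMap P a).symm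
  exact IsFractionRing.isFractionRing_of_isDomain_of_isLocalization P.primeCompl
    (Localization.AtPrime P) K

omit [IsIntegrallyClosed O] in
theorem localizationToFraction_injective : Function.Injective (localizationToFraction P K) := by
  let := (localizationToFraction P K).toAlgebra
  have := isFractionRing_localization P (K := K)
  exact IsFractionRing.injective (Localization.AtPrime P) K

omit [IsDomain O] [IsIntegrallyClosed O] in
theorem charZero_localization [CharZero K] : CharZero (Localization.AtPrime P) :=
  (localizationToFraction P K).charZero

omit [IsIntegrallyClosed O] in
theorem toFunctions_injective [CharZero K] (hK : ∀ H : Subgroup G, IsSplittingField K H) :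
    Function.Injective (toFunctions P K G) := by
  have := charZero_localization P (K := K)
  exact scalarFunctions_injective hK (localizationToFraction P K)
    (localizationToFraction_injective P)

/-- If all the values of `b` lie in `𝔭 O_𝔭` then the reduction of `b` is nilpotent, because
`∏ (b - b(g)) = 0`, the product being over `g ∈ G`. -/
theorem isNilpotent_reduction [CharZero K] (hK : ∀ H : Subgroup G, IsSplittingField K H)
    (b : ScalarCharRing (Localization.AtPrime P) K G)
    (hb : ∀ g, redEval P K (ConjClasses.mk g) (reduction P K G b) = 0) :
    IsNilpotent (reduction P K G b) := by
  have := Fintype.ofFinite G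
  have h1 : ∏ g : G, (b - algebraMap _ _ (localEval P K g b)) = 0 := by
    apply toFunctions_injective P hK
    funext g
    rw [map_prod, map_zero, Finset.prod_apply, Pi.zero_apply]
    refine Finset.prod_eq_zero (Finset.mem_univ g) ?_
    rw [← localizationToFraction_localEval, map_sub, Algebra.algebraMap_eq_smul_one,
      localEval_smul, map_one, mul_one, sub_self, map_zero]
  refine ⟨Fintype.card G, ?_⟩
  have h2 := congrArg (reduction P K G) h1
  rw [map_prod, map_zero] at h2
  rw [← h2, ← Finset.card_univ, ← Finset.prod_const]
  refine Finset.prod_congr rfl fun g _ => ?_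
  have h3 : reduction P K G (algebraMap _ _ (localEval P K g b)) =
      tensor (IsLocalRing.residue _ (localEval P K g b)) 1 := mapScalars_tensor _ _ _
  rw [map_sub, h3, residue_localEval, hb, ← algebraMap_eq_tensor, map_zero, sub_zero]

end LocalEvaluation

/-! ### The characteristic function of a `p'`-section -/

section SectionIdempotent

variable {O : Type*} [CommRing O] [IsDomain O] [IsIntegrallyClosed O] (P : Ideal O) [P.IsMaximal]
  {K : Type*} [Field K] [CharZero K] [Algebra O K] [IsFractionRing O K] {G : Type*} [Group G]
  [Finite G] (p : ℕ) [Fact p.Prime]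

omit [IsDomain O] in
/-- An element of `O_𝔭 R(G)` which vanishes outside of the `p'`-section of `x`, and whose value at
`x` is prime to `p`: the function `g ↦ |Q|⁻¹ * #{t | t⁻¹ g t ∈ x Q}`, where `Q` is a Sylow
`p`-subgroup of the centralizer of `x`. -/
theorem exists_supported_on_section (hK : ∀ H : Subgroup G, IsSplittingField K H) (x : G)
    (hx : (orderOf x).Coprime p) : ∃ b : ScalarCharRing (Localization.AtPrime P) K G,
      (∀ g, g ∉ pPrimeSection p (ConjClasses.mk x) → toFunctions P K G b g = 0) ∧
      ∃ d : ℕ, ¬ p ∣ d ∧ toFunctions P K G b x = d := by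
  let Z := Subgroup.centralizer {x}
  let Q₀ : Sylow p Z := default
  let Q : Subgroup G := (Q₀ : Subgroup Z).map Z.subtype
  have hQZ : ∀ u ∈ Q, Commute x u := by
    rintro _ ⟨u, -, rfl⟩
    exact (Subgroup.mem_centralizer_singleton_iff.1 u.2).symm
  have hQp : ∀ u ∈ Q, IsPElement p u := by
    rintro _ ⟨u, hu, rfl⟩
    obtain ⟨n, hn⟩ := IsPGroup.iff_orderOf.1 Q₀.isPGroup' ⟨u, hu⟩
    refine ⟨n, ?_⟩
    rw [← hn]
    exact (Subgroup.orderOf_coe u).trans (Subgroup.orderOf_mk u hu).symm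
  obtain ⟨ζ, hζ⟩ := exists_integral_primitiveRoot (O := O) hK x
  obtain ⟨χ, -, hχ⟩ := exists_charRing_eq_card x Q hQZ hζ
  have hb : ∀ g, toFunctions P K G (∑ j ∈ Finset.range (orderOf x),
      tensor (algebraMap O (Localization.AtPrime P) ζ ^ j) (χ j)) g =
        (Nat.card Q : K)⁻¹ * Nat.card {t : G // x⁻¹ * (t⁻¹ * g * t) ∈ Q} := by
    intro g
    rw [hχ, map_sum, Finset.sum_apply]
    refine Finset.sum_congr rfl fun j _ => ?_
    rw [show toFunctions P K G = scalarFunctions (localizationToFraction P K) from rfl,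
      scalarFunctions_tensor, map_pow, localizationToFraction_algebraMap]
    rfl
  refine ⟨∑ j ∈ Finset.range (orderOf x),
    tensor (algebraMap O (Localization.AtPrime P) ζ ^ j) (χ j), fun g hg => ?_,
    (Q₀ : Subgroup Z).index, Q₀.not_dvd_index, ?_⟩
  · rw [hb]
    have : IsEmpty {t : G // x⁻¹ * (t⁻¹ * g * t) ∈ Q} := by
      refine ⟨fun ⟨t, ht⟩ => hg ?_⟩
      have h1 : t⁻¹ * g * t = x * (x⁻¹ * (t⁻¹ * g * t)) := by group
      have h2 := congrArg (pPrimePart p) h1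
      have h3 := pPrimePart_conj p t⁻¹ g
      rw [inv_inv] at h3
      rw [pPrimePart_mul (hQZ _ ht) hx (hQp _ ht), h3] at h2
      rw [mem_pPrimeSection_iff, ConjClasses.mk_eq_mk_iff_isConj]
      exact isConj_iff.2 ⟨t⁻¹, by rw [inv_inv, h2]⟩
    rw [Nat.card_of_isEmpty (α := {t : G // x⁻¹ * (t⁻¹ * g * t) ∈ Q}), Nat.cast_zero, mul_zero]
  · rw [hb]
    have h1 : ∀ t : G, x⁻¹ * (t⁻¹ * x * t) ∈ Q ↔ t ∈ Z := by
      intro t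
      rw [Subgroup.mem_centralizer_singleton_iff]
      constructor
      · intro ht
        have h2 : t⁻¹ * x * t = x * (x⁻¹ * (t⁻¹ * x * t)) := by group
        have h3 := congrArg (pPrimePart p) h2
        have h4 := pPrimePart_conj p t⁻¹ x
        rw [inv_inv] at h4
        rw [pPrimePart_mul (hQZ _ ht) hx (hQp _ ht), h4, pPrimePart_eq_self p hx, mul_assoc,
          inv_mul_eq_iff_eq_mul] at h3
        exact h3.symm
      · intro ht
        rw [mul_assoc t⁻¹, ← ht, inv_mul_cancel_left, inv_mul_cancel]
        exact Q.one_mem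
    rw [Nat.card_congr (Equiv.subtypeEquivRight h1)]
    have h2 : Nat.card Q = Nat.card (Q₀ : Subgroup Z) :=
      Nat.card_congr ((Q₀ : Subgroup Z).equivMapOfInjective Z.subtype
        Subtype.val_injective).symm.toEquiv
    have h3 : (Nat.card Q : K) ≠ 0 := Nat.cast_ne_zero.2 Nat.card_pos.ne'
    rw [inv_mul_eq_iff_eq_mul₀ h3, h2, ← Nat.cast_mul, Subgroup.card_mul_index]

theorem section_closed_conj (C : ConjClasses G) (g h : G) (hgh : IsConj g h)
    (hg : g ∈ pPrimeSection p C) : h ∈ pPrimeSection p C :=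
  (mem_pPrimeSection_conj p C hgh).1 hg

/-- The characteristic function of a `p'`-section belongs to `O_𝔭 R(G)`. It is
`1 - ∏ (1 - b / b(h))`, the product being over the elements `h` of the section, for a virtual
character `b` supported on the section whose values there are units of `O_𝔭`; for the latter it
suffices that the value at `x` is a unit, as all the values are congruent modulo `𝔭`. -/
theorem exists_toFunctions_eq_indicator [CharP P.ResidueField p]
    (hK : ∀ H : Subgroup G, IsSplittingField K H) (C : ConjClasses G)
    (hC : IsPRegularClass p C) : ∃ e : ScalarCharRing (Localization.AtPrime P) K G,
      toFunctions P K G e = (pPrimeSection p C).indicator 1 := by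
  classical
  have := Fintype.ofFinite G
  obtain ⟨x, rfl⟩ := ConjClasses.exists_rep C
  change IsPRegularClass p (ConjClasses.mk x) at hC
  change ∃ e, toFunctions P K G e = (pPrimeSection p (ConjClasses.mk x)).indicator 1
  obtain ⟨b, hb0, d, hd, hbx⟩ :=
    exists_supported_on_section P p hK x (hC x ConjClasses.mem_carrier_mk)
  have hinj := localizationToFraction_injective P (K := K)
  have hunit : ∀ g ∈ pPrimeSection p (ConjClasses.mk x), IsUnit (localEval P K g b) := by
    intro g hg
    rw [← IsLocalRing.residue_ne_zero_iff_isUnit, residue_localEval,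
      redEval_pPrimePart P (p := p) hK, (mem_pPrimeSection_iff p _ g).1 hg,
      ← residue_localEval]
    have h1 : localEval P K x b = d := by
      apply hinj
      rw [localizationToFraction_localEval, hbx, map_natCast]
    rw [h1, map_natCast]
    intro h2
    exact hd ((CharP.cast_eq_zero_iff P.ResidueField p d).1 h2)
  refine ⟨1 - ∏ h ∈ Finset.univ.filter (· ∈ pPrimeSection p (ConjClasses.mk x)),
    (1 - Ring.inverse (localEval P K h b) • b), ?_⟩
  funext g
  rw [← localizationToFraction_localEval, map_sub, map_prod]
  simp only [map_sub, map_one, localEval_smul]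
  by_cases hg : g ∈ pPrimeSection p (ConjClasses.mk x)
  · rw [Finset.prod_eq_zero (i := g) (by simpa using hg), map_zero, sub_zero,
      Set.indicator_of_mem hg, Pi.one_apply]
    rw [Ring.inverse_mul_cancel _ (hunit g hg), sub_self]
  · have h1 : localEval P K g b = 0 := by
      apply hinj
      rw [localizationToFraction_localEval, hb0 g hg, map_zero]
    rw [Set.indicator_of_notMem hg, h1]
    simp

end SectionIdempotent

end CharacterRing

theorem proposition2p11 {O K G : Type*} [CommRing O] [IsDedekindDomain O] [CharZero O]
    (P : Ideal O) [P.IsMaximal] [Field K] [Algebra O K] [IsFractionRing O K]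
    (p : ℕ) [Fact p.Prime] [CharP P.ResidueField p] [Group G] [Finite G]
    (hK : ∀ H : Subgroup G, IsSplittingField K H)
    (hk : ∀ H : Subgroup G, IsSplittingField P.ResidueField H)
    (C : ConjClasses G) (hC : IsPRegularClass p C) :
    (∃! e : ScalarCharRing (Localization.AtPrime P) K G,
      toFunctions P K G e = (pPrimeSection p C).indicator 1) ∧
    ∀ e : ScalarCharRing (Localization.AtPrime P) K G,
      toFunctions P K G e = (pPrimeSection p C).indicator 1 →
      ∀ Q : Ideal (ScalarCharRing P.ResidueField K G), Q = Ideal.span {reduction P K G e} →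
        Module.Projective (ScalarCharRing P.ResidueField K G) Q ∧
        IsIndecomposable (ScalarCharRing P.ResidueField K G) Q ∧
        HasMultiplicity (ScalarCharRing P.ResidueField K G) Q (simpleMod P K C)
          (numClasses (pPrimeSection p C)) ∧
        (∀ C' : ConjClasses G, IsPRegularClass p C' → C ≠ C' →
          HasMultiplicity (ScalarCharRing P.ResidueField K G) Q (simpleMod P K C') 0) ∧
        Nonempty ((Q ⧸ Module.jacobson (ScalarCharRing P.ResidueField K G) Q)
          ≃ₗ[ScalarCharRing P.ResidueField K G] simpleMod P K C) ∧
        Module.finrank P.ResidueField Q = numClasses (pPrimeSection p C) ∧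
        ∀ g ∈ C.carrier, Module.finrank P.ResidueField Q =
          numClasses {h : Subgroup.centralizer {g} | IsPElement p h} := by
  have : CharZero K := charZero_of_injective_algebraMap (IsFractionRing.injective O K)
  have := Fintype.ofFinite G
  have := finite_charRing hK
  have := free_charRing hK
  have := charZero_localization P (K := K)
  have hinj := toFunctions_injective P hK
  obtain ⟨e₀, he₀⟩ := exists_toFunctions_eq_indicator P p hK C hC
  refine ⟨⟨e₀, he₀, fun e he => hinj (he.trans he₀.symm)⟩, ?_⟩
  rintro e he Q rfl
  have hee : e * e = e := by
    apply hinj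
    rw [map_mul, he]
    funext g
    by_cases hg : g ∈ pPrimeSection p C <;> simp [hg]
  have hloc : ∀ g, localizationToFraction P K (localEval P K g e) =
      (pPrimeSection p C).indicator 1 g := fun g => by
    rw [localizationToFraction_localEval, he]
  have hlinj := localizationToFraction_injective P (K := K)
  have hone : ∀ g ∈ pPrimeSection p C, localEval P K g e = 1 := fun g hg => hlinj (by
    rw [hloc, Set.indicator_of_mem hg, map_one, Pi.one_apply])
  have hzero : ∀ g ∉ pPrimeSection p C, localEval P K g e = 0 := fun g hg => hlinj (by
    rw [hloc, Set.indicator_of_notMem hg, map_zero])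
  have hone' : ∀ g ∈ pPrimeSection p C,
      redEval P K (ConjClasses.mk g) (reduction P K G e) = 1 := fun g hg => by
    rw [← residue_localEval, hone g hg, map_one]
  have hzero' : ∀ g ∉ pPrimeSection p C,
      redEval P K (ConjClasses.mk g) (reduction P K G e) = 0 := fun g hg => by
    rw [← residue_localEval, hzero g hg, map_zero]
  have hreg : ∀ C' : ConjClasses G, IsPRegularClass p C' → ∀ g, ConjClasses.mk g = C' →
      (g ∈ pPrimeSection p C ↔ C' = C) := by
    rintro _ hC' g rfl
    rw [mem_pPrimeSection_iff, pPrimePart_eq_self p (hC' g ConjClasses.mem_carrier_mk)]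
  have hf : ∀ c, redEval P K C (algebraMap _ _ c) = c := fun c => by
    rw [algebraMap_eq_tensor, redEval, liftScalars_tensor, map_one, mul_one, RingHom.id_apply]
  have hre : reduction P K G e * reduction P K G e = reduction P K G e := by
    rw [← map_mul, hee]
  have hfe : redEval P K C (reduction P K G e) = 1 := by
    obtain ⟨x, hx⟩ := ConjClasses.exists_rep C
    rw [← hx]
    exact hone' x ((hreg C hC x hx).2 rfl)
  have hπ : Function.Surjective (IsLocalRing.residue (Localization.AtPrime P)) :=
    IsLocalRing.residue_surjective
  have hred : Function.Surjective (reduction P K G) := mapScalars_surjective _ hπ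
  have hnil : ∀ a, redEval P K C a = 0 → IsNilpotent (a * reduction P K G e) := by
    intro a ha
    obtain ⟨b, rfl⟩ := hred a
    rw [← map_mul]
    -- The values of `b e` vanish outside of the section, and are congruent to the value of `b` at
    -- `C` inside.
    apply isNilpotent_reduction P hK
    intro g
    rw [map_mul, map_mul]
    by_cases hg : g ∈ pPrimeSection p C
    · rw [redEval_pPrimePart P (p := p) hK, (mem_pPrimeSection_iff p _ g).1 hg, ha, zero_mul]
    · rw [hzero' g hg, mul_zero]
  have hdim : Module.finrank P.ResidueField (Ideal.span {reduction P K G e}) =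
      numClasses (pPrimeSection p C) := by
    let := (localizationToFraction P K).toAlgebra
    have := isFractionRing_localization P (K := K)
    rw [← finrank_span_indicator (R := Localization.AtPrime P) hK (pPrimeSection p C)
      (section_closed_conj p C) hee he]
    exact finrank_span_map_idempotent (IsLocalRing.residue (Localization.AtPrime P)) hπ
      (reduction P K G) hred (fun a b => mapScalars_smul _ a b)
      (fun b hb => mem_smul_top_of_mapScalars_eq_zero _ b hb) hee
  refine ⟨projective_span_idempotent _ hre,
    isIndecomposable_block (redEval P K C) _ hre hfe hnil hf, ?_, fun C' hC' hne => ?_,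
    nonempty_quotient_jacobson_equiv (redEval P K C) _ hre hfe hnil hf, hdim, fun g hg => ?_⟩
  · rw [← hdim]
    exact hasMultiplicity_block (redEval P K C) _ hre hnil hf
  · refine hasMultiplicity_block_zero (redEval P K C) _ hre hfe hnil hf _ ?_
    obtain ⟨y, hy⟩ := ConjClasses.exists_rep C'
    rw [← hy]
    exact hzero' y fun h => hne ((hreg C' hC' y hy).1 h).symm
  · rw [hdim, numClasses_pPrimeSection p C hC g hg]
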